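/- Let $(\mathfrak A,\otimes,\mathbf 1)$ be a closed symmetric monoidal cocomplete additive category, and let $\mathrm{Ch}(\mathfrak A)$ be the symmetric monoidal category of ($\mathbb Z$-graded, unbounded) chain complexes in $\mathfrak A$, with the usual tensor product and the Koszul sign rule for the symmetry. A dg-operad is a (symmetric, unital) operad in $\mathrm{Ch}(\mathfrak A)$. For a dg-operad $P$, a $P$-coalgebra is a chain complex $V$ with maps $P(n)\otimes V\to V^{\otimes n}$, $n\ge 0$, which are equivariant, unital and compatible with the compositions of $P$. Assume that cofree coalgebras exist: for every dg-operad $Q$ the forgetful functor from $Q$-coalgebras to $\mathrm{Ch}(\mathfrak A)$ has a right adjoint $\mathrm{Cofree}_Q$. A dg-operad $P$ is called sane if the counit $\mathrm{Forget}(\mathrm{Cofree}_P X)\to X$ is an epimorphism for every chain complex $X$. Theorem (Sanity check). A dg-operad $P$ is sane if at least one of the following conditions holds: - $P$ admits an augmentation, i.e. a morphism of operads $P\to\mathbf 1$ to the unit operad ($\mathbf 1$ in arity $1$, and $0$ in all other arities); - $P$ is cofibrant, i.e. for every morphism $Q\to R$ of dg-operads which is a degree-wise epimorphism and a quasi-isomorphism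 (in each arity, the homology objects of both complexes exist and the induced maps on homology are isomorphisms), every morphism $P\to R$ lifts to a morphism $P\to Q$; - $P(0)$ is dualisable, i.e. $P(0)^\vee=[P(0),\mathbf 1]$ and $[P(0),P(0)]$ exist and the canonical map $P(0)\otimes P(0)^\vee\to[P(0),P(0)]$ is an isomorphism, and the unit $\mathbf 1\to P$ is a degree-wise split monomorphism, i.e. every component $\mathbf 1_k\to P(1)_k$, $k\in\mathbb Z$, is a split monomorphism in $\mathfrak A$. -/

import Mathlib

open CategoryTheory Limits MonoidalCategory

universe v u

namespace Koszul

section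
variable (A : Type u) [Category.{v} A] [Preadditive A] [MonoidalCategory A] [SymmetricCategory A]
  [MonoidalClosed A] [HasColimits A]

instance hasZeroObject : HasZeroObject A :=
  (initialIsInitial (C := A)).isZero.hasZeroObject

/-- The tensor product of a closed symmetric monoidal additive category is automatically additive. -/
instance monoidalPreadditive : MonoidalPreadditive A := by
  have : HasBinaryBiproducts A := HasBinaryBiproducts.of_hasBinaryCoproducts
  have hL (X : A) : (tensorLeft X).Additive := by
    have : PreservesColimitsOfShape (Discrete WalkingPair) (tensorLeft X) := inferInstance
    have := preservesBinaryBiproducts_of_preservesBinaryCoproducts (tensorLeft X)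
    exact Functor.additive_of_preservesBinaryBiproducts _
  have hR (X : A) : (tensorRight X).Additive :=
    Functor.additive_of_iso (BraidedCategory.tensorLeftIsoTensorRight X)
  exact
  { whiskerLeft_zero := fun {X Y Z} => (tensorLeft X).map_zero Y Z
    zero_whiskerRight := fun {X Y Z} => (tensorRight X).map_zero Y Z
    whiskerLeft_add := fun {X Y Z} f g => (tensorLeft X).map_add
    add_whiskerRight := fun {X Y Z} f g => (tensorRight X).map_add }

instance preservesLeft (X : A) :
    PreservesColimitsOfSize.{v, v} ((curriedTensor A).obj X) :=
  inferInstanceAs (PreservesColimitsOfSize.{v, v} (tensorLeft X))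

instance preservesRight (X : A) :
    PreservesColimitsOfSize.{v, v} ((curriedTensor A).flip.obj X) :=
  preservesColimits_of_natIso (BraidedCategory.tensorLeftIsoTensorRight X)

/-- The differential of `K ⊗ L` is `d (x ⊗ y) = d x ⊗ y + (-1) ^ |x| x ⊗ d y`. -/
instance tensorSigns : ComplexShape.TensorSigns (ComplexShape.down ℤ) where
  ε' := MonoidHom.mk' (fun i : ℤ => Int.negOnePow i) Int.negOnePow_add
  rel_add p q r (hpq : q + 1 = p) := by change _ + 1 = _; lia
  add_rel p q r (hpq : q + 1 = p) := by change _ + 1 = _; lia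
  ε'_succ := by
    rintro _ q rfl
    change q.negOnePow = - (q+1).negOnePow
    rw [Int.negOnePow_succ, neg_neg]

instance hasTensor (X Y : GradedObject ℤ A) : GradedObject.HasTensor X Y := inferInstance

instance hasMapBifunctor (K L : ChainComplex A ℤ) :
    HomologicalComplex.HasMapBifunctor K L (curriedTensor A) (ComplexShape.down ℤ) := inferInstance

/-- The tensor product of chain complexes, as constructed in Mathlib. -/
noncomputable instance monoidal : MonoidalCategory (ChainComplex A ℤ) :=
  HomologicalComplex.monoidalCategory A _

noncomputable instance monoidalStruct : MonoidalCategoryStruct (ChainComplex A ℤ) :=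
  (monoidal A).toMonoidalCategoryStruct

variable {A}

section

open HomologicalComplex

/-- The symmetry `x ⊗ y ↦ (-1) ^ (|x| * |y|) y ⊗ x` of the tensor product of chain complexes. -/
noncomputable def koszulHom (K L : ChainComplex A ℤ) : K ⊗ L ⟶ L ⊗ K where
  f n := mapBifunctorDesc fun i j h =>
    (i * j).negOnePow • ((β_ (K.X i) (L.X j)).hom ≫
      ιTensorObj L K j i n ((add_comm j i).trans h))
  comm' := by
    rintro n m hnm
    have hnm' : m + 1 = n := hnm
    apply mapBifunctor.hom_ext
    intro i j h
    have h' : i + j = n := h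
    rw [ι_mapBifunctorDesc_assoc]
    change _ ≫ (mapBifunctor L K _ _).d n m = _ ≫ (mapBifunctor K L _ _).d n m ≫ _
    have hi : (ComplexShape.down ℤ).Rel i (i-1) := by change _ + 1 = _; lia
    have hj : (ComplexShape.down ℤ).Rel j (j-1) := by change _ + 1 = _; lia
    have e1 : ComplexShape.π (ComplexShape.down ℤ) (ComplexShape.down ℤ) (ComplexShape.down ℤ) (i-1, j) = m := by change i - 1 + j = m; lia
    have e2 : ComplexShape.π (ComplexShape.down ℤ) (ComplexShape.down ℤ) (ComplexShape.down ℤ) (i, j-1) = m := by change i + (j-1) = m; lia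
    have e3 : ComplexShape.π (ComplexShape.down ℤ) (ComplexShape.down ℤ) (ComplexShape.down ℤ) (j-1, i) = m := by change j - 1 + i = m; lia
    have e4 : ComplexShape.π (ComplexShape.down ℤ) (ComplexShape.down ℤ) (ComplexShape.down ℤ) (j, i-1) = m := by change j + (i-1) = m; lia
    rw [mapBifunctor.d_eq, mapBifunctor.d_eq, Preadditive.add_comp, Preadditive.comp_add,
      Preadditive.comp_add, mapBifunctor.ι_D₁_assoc, mapBifunctor.ι_D₂_assoc,
      Linear.units_smul_comp, Linear.units_smul_comp, Category.assoc, Category.assoc,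
      mapBifunctor.ι_D₁, mapBifunctor.ι_D₂,
      mapBifunctor.d₁_eq _ _ _ _ hi _ _ e1, mapBifunctor.d₂_eq _ _ _ _ _ hj _ e2,
      mapBifunctor.d₁_eq _ _ _ _ hj _ _ e3, mapBifunctor.d₂_eq _ _ _ _ _ hi _ e4,
      Linear.units_smul_comp, Linear.units_smul_comp, Category.assoc, Category.assoc,
      ι_mapBifunctorDesc, ι_mapBifunctorDesc]
    dsimp only [curriedTensor_obj_map, curriedTensor_map_app, curriedTensor_obj_obj]
    simp only [Linear.comp_units_smul, smul_smul,
      BraidedCategory.braiding_naturality_left_assoc,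
      BraidedCategory.braiding_naturality_right_assoc]
    have s1 : (i * j).negOnePow * ComplexShape.ε₁ (ComplexShape.down ℤ) (ComplexShape.down ℤ)
          (ComplexShape.down ℤ) (j, i) =
        ComplexShape.ε₂ (ComplexShape.down ℤ) (ComplexShape.down ℤ) (ComplexShape.down ℤ) (i, j) *
          (i * (j - 1)).negOnePow := by
      change (i * j).negOnePow * 1 = i.negOnePow * _
      rw [mul_one, ← Int.negOnePow_add]
      congr 1
      ring
    have s2 : (i * j).negOnePow * ComplexShape.ε₂ (ComplexShape.down ℤ) (ComplexShape.down ℤ)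
          (ComplexShape.down ℤ) (j, i) =
        ComplexShape.ε₁ (ComplexShape.down ℤ) (ComplexShape.down ℤ) (ComplexShape.down ℤ) (i, j) *
          ((i - 1) * j).negOnePow := by
      change (i * j).negOnePow * j.negOnePow = 1 * _
      rw [one_mul, ← Int.negOnePow_add]
      have : i * j + j = (i - 1) * j + 2 * j := by ring
      rw [this, Int.negOnePow_add, Int.negOnePow_two_mul, mul_one]
    rw [s1, s2, add_comm]

@[simp]
lemma ι_koszulHom (K L : ChainComplex A ℤ) (i j n : ℤ) (h : i + j = n) :
    ιTensorObj K L i j n h ≫ (koszulHom K L).f n =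
      (i * j).negOnePow • ((β_ (K.X i) (L.X j)).hom ≫
        ιTensorObj L K j i n ((add_comm j i).trans h)) :=
  ι_mapBifunctorDesc (K₁ := K) (K₂ := L) (F := curriedTensor A) (c := ComplexShape.down ℤ)
    (fun i j h => (i * j).negOnePow • ((β_ (K.X i) (L.X j)).hom ≫
      ιTensorObj L K j i n ((add_comm j i).trans h))) i j h

lemma ι_whiskerLeft (K : ChainComplex A ℤ) {L M : ChainComplex A ℤ} (g : L ⟶ M)
    (i j n : ℤ) (h : i + j = n) :
    ιTensorObj K L i j n h ≫ (K ◁ g).f n = K.X i ◁ g.f j ≫ ιTensorObj K M i j n h := by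
  refine (ι_mapBifunctorMap (𝟙 K) g (curriedTensor A) _ i j n h).trans ?_
  simp

lemma ι_whiskerRight {K L : ChainComplex A ℤ} (g : K ⟶ L) (M : ChainComplex A ℤ)
    (i j n : ℤ) (h : i + j = n) :
    ιTensorObj K M i j n h ≫ (g ▷ M).f n = g.f i ▷ M.X j ≫ ιTensorObj L M i j n h := by
  refine (ι_mapBifunctorMap g (𝟙 M) (curriedTensor A) _ i j n h).trans ?_
  simp

lemma koszulHom_koszulHom (K L : ChainComplex A ℤ) : koszulHom K L ≫ koszulHom L K = 𝟙 _ := by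
  ext n
  apply mapBifunctor.hom_ext
  intro i j h
  have := ι_koszulHom K L i j n h
  have := ι_koszulHom L K j i n ((add_comm j i).trans h)
  rw [HomologicalComplex.comp_f]
  erw [reassoc_of% ι_koszulHom K L i j n h]
  rw [Linear.units_smul_comp, Category.assoc]
  erw [ι_koszulHom L K j i n ((add_comm j i).trans h)]
  rw [Linear.comp_units_smul, smul_smul, mul_comm j i, Int.units_mul_self, one_smul,
    SymmetricCategory.symmetry_assoc]
  exact (Category.comp_id _).symm

section

open GradedObject GradedObject.Monoidal
/-- The symmetry with Koszul signs on the underlying graded objects. -/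
noncomputable def gb (X Y : GradedObject ℤ A) :
    GradedObject.Monoidal.tensorObj X Y ⟶ GradedObject.Monoidal.tensorObj Y X := fun n =>
  GradedObject.Monoidal.tensorObjDesc fun i j h => (i * j).negOnePow • ((β_ (X i) (Y j)).hom ≫
      GradedObject.Monoidal.ιTensorObj Y X j i n ((add_comm j i).trans h))

lemma koszulHom_f (K L : ChainComplex A ℤ) (n : ℤ) : (koszulHom K L).f n = gb K.X L.X n := rfl

lemma associator_hom_f (K L M : ChainComplex A ℤ) (n : ℤ) :
   (α_ K L M).hom.f n = (GradedObject.Monoidal.associator K.X L.X M.X).hom n := rfl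
lemma associator_inv_f (K L M : ChainComplex A ℤ) (n : ℤ) :
   (α_ K L M).inv.f n = (GradedObject.Monoidal.associator K.X L.X M.X).inv n := rfl
lemma wL (K : ChainComplex A ℤ) {L M : ChainComplex A ℤ} (g : L ⟶ M) (n : ℤ) :
   (K ◁ g).f n = GradedObject.Monoidal.whiskerLeft K.X (Y₁ := L.X) (Y₂ := M.X) g.f n := by
   apply GradedObject.Monoidal.tensorObj_ext
   intro i j h
   refine (ι_whiskerLeft K g i j n h).trans ?_
   refine Eq.trans ?_ (GradedObject.Monoidal.ι_tensorHom _ _ _ _ _ _).symm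
   simp
   rfl

lemma ι_gb (X Y : GradedObject ℤ A) (i j n : ℤ) (h : i + j = n) :
   GradedObject.Monoidal.ιTensorObj X Y i j n h ≫ gb X Y n = (i * j).negOnePow • (GradedObject.Monoidal.ιTensorObj X Y i j n h ≫ (GradedObject.Monoidal.braiding X Y).hom n) := by
   simp [gb, GradedObject.Monoidal.braiding]

lemma wR {K L : ChainComplex A ℤ} (g : K ⟶ L) (M : ChainComplex A ℤ) (n : ℤ) :
   (g ▷ M).f n = GradedObject.Monoidal.whiskerRight (X₁ := K.X) (X₂ := L.X) g.f M.X n := by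
   apply GradedObject.Monoidal.tensorObj_ext
   intro i j h
   refine (ι_whiskerRight g M i j n h).trans ?_
   refine Eq.trans ?_ (GradedObject.Monoidal.ι_tensorHom _ _ _ _ _ _).symm
   simp
   rfl

lemma whiskerRight_units_smul {X Y : A} (r : ℤˣ) (f : X ⟶ Y) (Z : A) :
    (r • f) ▷ Z = r • (f ▷ Z) := by
  rw [Units.smul_def, Units.smul_def]
  exact map_zsmul (tensorRight Z).mapAddHom _ _

lemma whiskerLeft_units_smul {X Y : A} (r : ℤˣ) (f : X ⟶ Y) (Z : A) :
    Z ◁ (r • f) = r • (Z ◁ f) := by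
  rw [Units.smul_def, Units.smul_def]
  exact map_zsmul (tensorLeft Z).mapAddHom _ _

lemma ι_assoc (X Y Z : GradedObject ℤ A) (i j k n : ℤ) (h : i + j + k = n) {T : A}
    (f : GradedObject.Monoidal.tensorObj X (GradedObject.Monoidal.tensorObj Y Z) n ⟶ T) :
    ιTensorObj₃' X Y Z i j k n h ≫ (GradedObject.Monoidal.associator X Y Z).hom n ≫ f =
      (α_ _ _ _).hom ≫ ιTensorObj₃ X Y Z i j k n h ≫ f := by
  have := ιTensorObj₃'_associator_hom (X₁ := X) (X₂ := Y) (X₃ := Z) i j k n h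
  rw [← Category.assoc, this, Category.assoc]

lemma stepL (X Y Z : GradedObject ℤ A) (i j k n : ℤ) (h : i + j + k = n) :
    ιTensorObj₃' X Y Z i j k n h ≫ (GradedObject.Monoidal.associator X Y Z).hom n ≫ gb X (GradedObject.Monoidal.tensorObj Y Z) n =
    (i * (j + k)).negOnePow • (ιTensorObj₃' X Y Z i j k n h ≫ (GradedObject.Monoidal.associator X Y Z).hom n ≫
      (GradedObject.Monoidal.braiding X (GradedObject.Monoidal.tensorObj Y Z)).hom n) := by
  rw [ι_assoc, ι_assoc, ιTensorObj₃_eq X Y Z i j k n h _ rfl, Category.assoc, Category.assoc, ι_gb,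
    Linear.comp_units_smul, Linear.comp_units_smul]

lemma stepR1 (X Y Z : GradedObject ℤ A) (i j k n : ℤ) (h : i + j + k = n) :
    ιTensorObj₃' X Y Z i j k n h ≫ GradedObject.Monoidal.whiskerRight (gb X Y) Z n =
    (i * j).negOnePow • (ιTensorObj₃' X Y Z i j k n h ≫
      GradedObject.Monoidal.whiskerRight (GradedObject.Monoidal.braiding X Y).hom Z n) := by
  rw [ιTensorObj₃'_eq X Y Z i j k n h _ rfl, Category.assoc, Category.assoc,
    ι_tensorHom, ι_tensorHom]
  rw [← tensorHom_id, ← Category.assoc, ← Category.assoc,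
    MonoidalCategory.tensorHom_comp_tensorHom, MonoidalCategory.tensorHom_comp_tensorHom,
    ι_gb]
  simp only [categoryOfGradedObjects_id, Category.id_comp, MonoidalCategory.tensorHom_id]
  rw [whiskerRight_units_smul, Linear.units_smul_comp]

lemma stepR2 (X Y Z : GradedObject ℤ A) (i j k n : ℤ) (h : i + j + k = n) :
    ιTensorObj₃' X Y Z i j k n h ≫
      GradedObject.Monoidal.whiskerRight (GradedObject.Monoidal.braiding X Y).hom Z n =
    (β_ (X i) (Y j)).hom ▷ Z k ≫ ιTensorObj₃' Y X Z j i k n ((by rw [add_comm j i]; exact h)) := by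
  rw [ιTensorObj₃'_eq X Y Z i j k n h _ rfl, Category.assoc,
    ι_tensorHom, ιTensorObj₃'_eq Y X Z j i k n _ (i + j) (add_comm _ _)]
  rw [← tensorHom_id, ← Category.assoc, ← tensorHom_id, ← tensorHom_id, ← Category.assoc,
    MonoidalCategory.tensorHom_comp_tensorHom, MonoidalCategory.tensorHom_comp_tensorHom]
  simp [GradedObject.Monoidal.braiding]

lemma stepR3 (X Y Z : GradedObject ℤ A) (i j k n : ℤ) (h : i + j + k = n) :
    ιTensorObj₃ X Y Z i j k n h ≫ GradedObject.Monoidal.whiskerLeft X (gb Y Z) n =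
    (j * k).negOnePow • (ιTensorObj₃ X Y Z i j k n h ≫
      GradedObject.Monoidal.whiskerLeft X (GradedObject.Monoidal.braiding Y Z).hom n) := by
  rw [ιTensorObj₃_eq X Y Z i j k n h _ rfl, Category.assoc, Category.assoc,
    ι_tensorHom, ι_tensorHom]
  rw [← id_tensorHom, ← Category.assoc, ← Category.assoc,
    MonoidalCategory.tensorHom_comp_tensorHom, MonoidalCategory.tensorHom_comp_tensorHom,
    ι_gb]
  simp only [categoryOfGradedObjects_id, Category.id_comp, MonoidalCategory.id_tensorHom]
  rw [whiskerLeft_units_smul, Linear.units_smul_comp]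

lemma gb_hexagon (X Y Z : GradedObject ℤ A) (n : ℤ) :
    (GradedObject.Monoidal.associator X Y Z).hom n ≫ gb X (GradedObject.Monoidal.tensorObj Y Z) n ≫
      (GradedObject.Monoidal.associator Y Z X).hom n =
    GradedObject.Monoidal.whiskerRight (gb X Y) Z n ≫ (GradedObject.Monoidal.associator Y X Z).hom n ≫
      GradedObject.Monoidal.whiskerLeft Y (gb X Z) n := by
  apply tensorObj₃'_ext
  intro i j k h
  have key := ιTensorObj₃' X Y Z i j k n h ≫=
    congrFun (GradedObject.Monoidal.hexagon_forward X Y Z) n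
  have h1 := stepL X Y Z i j k n h =≫ (GradedObject.Monoidal.associator Y Z X).hom n
  have h2 := stepR1 X Y Z i j k n h =≫ ((GradedObject.Monoidal.associator Y X Z).hom n ≫
      GradedObject.Monoidal.whiskerLeft Y (gb X Z) n)
  have h3 := stepR2 X Y Z i j k n h =≫ ((GradedObject.Monoidal.associator Y X Z).hom n ≫
      GradedObject.Monoidal.whiskerLeft Y (gb X Z) n)
  have h4 := stepR2 X Y Z i j k n h =≫ ((GradedObject.Monoidal.associator Y X Z).hom n ≫
      GradedObject.Monoidal.whiskerLeft Y (GradedObject.Monoidal.braiding X Z).hom n)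
  simp only [categoryOfGradedObjects_comp] at key
  rw [Linear.units_smul_comp] at h1 h2
  simp only [Category.assoc] at h1 h2 h3 h4
  rw [ι_assoc] at h3 h4
  rw [h1, key, h2, h3, h4, stepR3]
  simp only [Linear.comp_units_smul, smul_smul]
  rw [mul_add, Int.negOnePow_add]

lemma koszul_hexagon (X Y Z : ChainComplex A ℤ) :
    (α_ X Y Z).hom ≫ koszulHom X (Y ⊗ Z) ≫ (α_ Y Z X).hom =
      koszulHom X Y ▷ Z ≫ (α_ Y X Z).hom ≫ Y ◁ koszulHom X Z := by
  ext n
  simp only [HomologicalComplex.comp_f]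
  rw [wL, wR]
  exact gb_hexagon X.X Y.X Z.X n

lemma koszul_nat_right (X : ChainComplex A ℤ) {Y Z : ChainComplex A ℤ} (f : Y ⟶ Z) :
    X ◁ f ≫ koszulHom X Z = koszulHom X Y ≫ f ▷ X := by
  ext n
  apply mapBifunctor.hom_ext
  intro i j h
  have h' : j + i = n := (add_comm j i).trans h
  have e1 := ι_whiskerLeft X f i j n h =≫ (koszulHom X Z).f n
  have e2 := ι_koszulHom X Y i j n h =≫ (f ▷ X).f n
  have e3 := ι_koszulHom X Z i j n h
  have e4 := ι_whiskerRight f X j i n h'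
  rw [Category.assoc, Category.assoc] at e1
  rw [Category.assoc, Linear.units_smul_comp, Category.assoc] at e2
  refine e1.trans (Eq.trans ?_ e2.symm)
  rw [e3, e4, Linear.comp_units_smul, BraidedCategory.braiding_naturality_right_assoc]

lemma koszul_nat_left {X Y : ChainComplex A ℤ} (f : X ⟶ Y) (Z : ChainComplex A ℤ) :
    f ▷ Z ≫ koszulHom Y Z = koszulHom X Z ≫ Z ◁ f := by
  have h := koszulHom X Z ≫= (koszul_nat_right Z f =≫ koszulHom Y Z)
  rw [Category.assoc, Category.assoc, koszulHom_koszulHom, Category.comp_id,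
    reassoc_of% koszulHom_koszulHom X Z] at h
  exact h.symm

lemma koszul_hexagon_reverse (X Y Z : ChainComplex A ℤ) :
    (α_ X Y Z).inv ≫ koszulHom (X ⊗ Y) Z ≫ (α_ Z X Y).inv =
      X ◁ koszulHom Y Z ≫ (α_ X Z Y).inv ≫ koszulHom X Z ▷ Y := by
  let e (K L : ChainComplex A ℤ) : K ⊗ L ≅ L ⊗ K :=
    { hom := koszulHom K L
      inv := koszulHom L K
      hom_inv_id := koszulHom_koszulHom K L
      inv_hom_id := koszulHom_koszulHom L K }
  have h : (α_ Z X Y) ≪≫ e Z (X ⊗ Y) ≪≫ (α_ X Y Z) =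
      whiskerRightIso (e Z X) Y ≪≫ (α_ X Z Y) ≪≫ whiskerLeftIso X (e Z Y) :=
    Iso.ext (koszul_hexagon Z X Y)
  have h' := congrArg Iso.inv h
  simp only [Iso.trans_inv, whiskerRightIso_inv, whiskerLeftIso_inv, Category.assoc] at h'
  exact h'
end

end

end

/-- The symmetric monoidal category of (unbounded) chain complexes. -/
noncomputable instance symmetric {A : Type u} [Category.{v} A] [Preadditive A]
    [MonoidalCategory A] [SymmetricCategory A] [MonoidalClosed A] [HasColimits A] :
    SymmetricCategory (ChainComplex A ℤ) where
  braiding K L :=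
    { hom := koszulHom K L
      inv := koszulHom L K
      hom_inv_id := koszulHom_koszulHom K L
      inv_hom_id := koszulHom_koszulHom L K }
  braiding_naturality_right X Y Z f := koszul_nat_right X f
  braiding_naturality_left f Z := koszul_nat_left f Z
  hexagon_forward X Y Z := koszul_hexagon X Y Z
  hexagon_reverse X Y Z := koszul_hexagon_reverse X Y Z
  symmetry K L := koszulHom_koszulHom K L

open HomologicalComplex in
instance chainMonoidalPreadditive {A : Type u} [Category.{v} A] [Preadditive A]
    [MonoidalCategory A] [SymmetricCategory A] [MonoidalClosed A] [HasColimits A] :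
    MonoidalPreadditive (ChainComplex A ℤ) where
  whiskerLeft_zero {K L M} := by
    ext n
    apply mapBifunctor.hom_ext
    intro i j h
    refine (ι_whiskerLeft K (0 : L ⟶ M) i j n h).trans ?_
    simp
  zero_whiskerRight {K L M} := by
    ext n
    apply mapBifunctor.hom_ext
    intro i j h
    refine (ι_whiskerRight (0 : L ⟶ M) K i j n h).trans ?_
    simp
  whiskerLeft_add {K L M} f g := by
    ext n
    apply mapBifunctor.hom_ext
    intro i j h
    rw [HomologicalComplex.add_f_apply, Preadditive.comp_add]
    erw [ι_whiskerLeft K (f + g) i j n h, ι_whiskerLeft K f i j n h, ι_whiskerLeft K g i j n h]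
    simp
  add_whiskerRight {K L M} f g := by
    ext n
    apply mapBifunctor.hom_ext
    intro i j h
    rw [HomologicalComplex.add_f_apply, Preadditive.comp_add]
    erw [ι_whiskerRight (f + g) K i j n h, ι_whiskerRight f K i j n h,
      ι_whiskerRight g K i j n h]
    simp

end Koszul

namespace Operad

/-- The bijection `{∗} ⊔ S ≃ {none} ⊔ S`. -/
def finOneSumEquiv (S : Type) : Fin 1 ⊕ S ≃ Option S where
  toFun := Sum.elim (fun _ => none) some
  invFun := fun x => x.elim (Sum.inl 0) Sum.inr
  left_inv := by
    rintro (x | x)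
    · exact congrArg Sum.inl (Subsingleton.elim _ _)
    · rfl
  right_inv := by rintro (_ | x) <;> rfl

/-- Moves the input `none` of `Option T` out of the disjoint union `Option T ⊔ S`. -/
def optionSumEquiv (T S : Type) : Option T ⊕ S ≃ Option (T ⊕ S) where
  toFun := Sum.elim (fun x => x.elim none (fun t => some (Sum.inl t))) (fun s => some (Sum.inr s))
  invFun := fun x => x.elim (Sum.inl none) (Sum.map some id)
  left_inv := by rintro ((_ | t) | s) <;> rfl
  right_inv := by rintro (_ | (t | s)) <;> rfl

/-- Moves the input `none` of `Option S` out of the disjoint union `T ⊔ Option S`. -/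
def sumOptionEquiv (T S : Type) : T ⊕ Option S ≃ Option (T ⊕ S) where
  toFun := Sum.elim (fun t => some (Sum.inl t)) (fun x => x.elim none (fun s => some (Sum.inr s)))
  invFun := fun x => x.elim (Sum.inr none) (Sum.map id some)
  left_inv := by rintro (t | (_ | s)) <;> rfl
  right_inv := by rintro (_ | (t | s)) <;> rfl

/-- Exchanges the two extra points `none` and `some none` of `Option (Option S)`. -/
def optionSwapEquiv (S : Type) : Option (Option S) ≃ Option (Option S) where
  toFun := fun x => x.elim (some none) (fun y => y.elim none (fun s => some (some s)))
  invFun := fun x => x.elim (some none) (fun y => y.elim none (fun s => some (some s)))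
  left_inv := by rintro (_ | (_ | s)) <;> rfl
  right_inv := by rintro (_ | (_ | s)) <;> rfl

/-- The bijection `T ⊔ (U ⊔ S) ≃ U ⊔ (T ⊔ S)`. -/
def sumSwapEquiv (T U S : Type) : T ⊕ (U ⊕ S) ≃ U ⊕ (T ⊕ S) where
  toFun := Sum.elim (fun t => Sum.inr (Sum.inl t)) (Sum.map id Sum.inr)
  invFun := Sum.elim (fun u => Sum.inr (Sum.inl u)) (Sum.map id Sum.inr)
  left_inv := by rintro (t | (u | s)) <;> rfl
  right_inv := by rintro (u | (t | s)) <;> rfl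

end Operad

open Operad in

/-- A symmetric operad with unit in a symmetric monoidal category, presented through partial
compositions on finite sets: `obj S` is the object of operations with inputs labelled by `S`
(so `obj (Fin n)` is `P(n)`), `map e` relabels the input `s` as `e s` (so bijections of `Fin n` give
the action of the symmetric group on `P(n)`), and `comp S T` inserts
an operation with inputs `T` in the input `none` of an operation with inputs `Option S`. -/
structure Operad (C : Type u) [Category.{v} C] [MonoidalCategory C] [SymmetricCategory C] where
  obj (S : Type) [Finite S] : C
  map {S T : Type} [Finite S] [Finite T] (e : S ≃ T) : obj S ⟶ obj T
  one : 𝟙_ C ⟶ obj (Fin 1)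
  comp (S T : Type) [Finite S] [Finite T] : obj (Option S) ⊗ obj T ⟶ obj (T ⊕ S)
  map_refl (S : Type) [Finite S] : map (Equiv.refl S) = 𝟙 (obj S)
  map_trans {S T U : Type} [Finite S] [Finite T] [Finite U] (e : S ≃ T) (f : T ≃ U) :
    map (e.trans f) = map e ≫ map f
  comp_natural {S S' T T' : Type} [Finite S] [Finite S'] [Finite T] [Finite T']
    (e : S ≃ S') (f : T ≃ T') :
    (map (Equiv.optionCongr e) ⊗ₘ map f) ≫ comp S' T' = comp S T ≫ map (Equiv.sumCongr f e)
  /-- The unit is a left unit: inserting an operation in the only input of the identity. -/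
  one_comp (T : Type) [Finite T] :
    (one ≫ map (finSuccEquiv 0)) ▷ obj T ≫ comp (Fin 0) T ≫ map (Equiv.sumEmpty T (Fin 0)) =
      (λ_ (obj T)).hom
  /-- The unit is a right unit: inserting the identity in the input `none`. -/
  comp_one (S : Type) [Finite S] :
    obj (Option S) ◁ one ≫ comp S (Fin 1) ≫ map (finOneSumEquiv S) = (ρ_ (obj (Option S))).hom
  /-- Sequential associativity. -/
  assoc (S T U : Type) [Finite S] [Finite T] [Finite U] :
    (comp S (Option T) ≫ map (optionSumEquiv T S)) ▷ obj U ≫ comp (T ⊕ S) U =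
      (α_ (obj (Option S)) (obj (Option T)) (obj U)).hom ≫ obj (Option S) ◁ comp T U ≫
        comp S (U ⊕ T) ≫ map (Equiv.sumAssoc U T S)
  /-- Parallel associativity: insertions in two different inputs commute. -/
  comm (S T U : Type) [Finite S] [Finite T] [Finite U] :
    (comp (Option S) T ≫ map (sumOptionEquiv T S)) ▷ obj U ≫ comp (T ⊕ S) U =
      (α_ (obj (Option (Option S))) (obj T) (obj U)).hom ≫
        obj (Option (Option S)) ◁ (β_ (obj T) (obj U)).hom ≫
        (α_ (obj (Option (Option S))) (obj U) (obj T)).inv ≫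
        (map (optionSwapEquiv S) ▷ obj U ≫ comp (Option S) U ≫
          map (sumOptionEquiv U S)) ▷ obj T ≫
        comp (U ⊕ S) T ≫ map (sumSwapEquiv T U S)

namespace Operad

section Morphisms

variable {C : Type u} [Category.{v} C] [MonoidalCategory C] [SymmetricCategory C]

/-- Morphisms of operads. -/
@[ext]
structure Hom (P Q : Operad C) where
  app (S : Type) [Finite S] : P.obj S ⟶ Q.obj S
  naturality {S T : Type} [Finite S] [Finite T] (e : S ≃ T) :
    P.map e ≫ app T = app S ≫ Q.map e
  one : P.one ≫ app (Fin 1) = Q.one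
  comp (S T : Type) [Finite S] [Finite T] :
    P.comp S T ≫ app (T ⊕ S) = (app (Option S) ⊗ₘ app T) ≫ Q.comp S T

instance : Category (Operad C) where
  Hom := Hom
  id P :=
    { app := fun S _ => 𝟙 (P.obj S)
      naturality := fun e => by simp
      one := by simp
      comp := fun S T _ _ => by simp }
  comp {P Q R} f g :=
    { app := fun S _ => f.app S ≫ g.app S
      naturality := fun e => by
        rw [← Category.assoc, f.naturality, Category.assoc, g.naturality, Category.assoc]
      one := by rw [← Category.assoc, f.one, g.one]
      comp := fun S T _ _ => by
        rw [← Category.assoc, f.comp, Category.assoc, g.comp, ← Category.assoc,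
          MonoidalCategory.tensorHom_comp_tensorHom] }

end Morphisms

section Unit

variable (C : Type u) [Category.{v} C] [Preadditive C] [HasZeroObject C] [MonoidalCategory C]
  [SymmetricCategory C]

open scoped ZeroObject

open Classical in
/-- The underlying objects of the unit operad: the tensor unit in arity one, and zero in all other
arities. -/
noncomputable def unitObj (S : Type) : C := if Nat.card S = 1 then 𝟙_ C else 0

/-- The map `𝟙_ C ⟶ unitObj C S`, which is the identity in arity one and zero otherwise. -/
noncomputable def unitIn (S : Type) : 𝟙_ C ⟶ unitObj C S :=
  open Classical in
  if h : Nat.card S = 1 then eqToHom (if_pos h).symm else 0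

/-- The map `unitObj C S ⟶ 𝟙_ C`, which is the identity in arity one and zero otherwise. -/
noncomputable def unitOut (S : Type) : unitObj C S ⟶ 𝟙_ C :=
  open Classical in
  if h : Nat.card S = 1 then eqToHom (if_pos h) else 0

variable {C} in
lemma unitIn_out {S : Type} (h : Nat.card S = 1) : unitIn C S ≫ unitOut C S = 𝟙 _ := by
  rw [unitIn, unitOut, dif_pos h, dif_pos h]
  exact eqToHom_trans _ _

lemma isZero_unitObj {S : Type} (h : Nat.card S ≠ 1) : IsZero (unitObj C S) := by
  rw [unitObj, if_neg h]
  exact isZero_zero C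

lemma unitOut_in (S : Type) : unitOut C S ≫ unitIn C S = 𝟙 _ := by
  by_cases h : Nat.card S = 1
  · rw [unitIn, unitOut, dif_pos h, dif_pos h]
    exact eqToHom_trans _ _
  · exact (isZero_unitObj C h).eq_of_src _ _

variable [MonoidalPreadditive C]

variable {C} in
lemma isZero_tensor_left {X : C} (h : IsZero X) (Y : C) : IsZero (X ⊗ Y) := by
  rw [IsZero.iff_id_eq_zero] at h ⊢
  rw [← MonoidalCategory.id_whiskerRight, h, MonoidalPreadditive.zero_whiskerRight]

variable {C} in
lemma isZero_tensor_right {X : C} (h : IsZero X) (Y : C) : IsZero (Y ⊗ X) := by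
  rw [IsZero.iff_id_eq_zero] at h ⊢
  rw [← MonoidalCategory.whiskerLeft_id, h, MonoidalPreadditive.whiskerLeft_zero]

variable {C} in
lemma unit_assoc_aux {X Y Z : C} (a : X ⟶ 𝟙_ C) (b : Y ⟶ 𝟙_ C) (c : Z ⟶ 𝟙_ C) :
    (((a ⊗ₘ b) ≫ (λ_ (𝟙_ C)).hom) ⊗ₘ c) ≫ (λ_ (𝟙_ C)).hom =
      (α_ X Y Z).hom ≫ (a ⊗ₘ ((b ⊗ₘ c) ≫ (λ_ (𝟙_ C)).hom)) ≫ (λ_ (𝟙_ C)).hom := by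
  have h1 : ((a ⊗ₘ b) ≫ (λ_ (𝟙_ C)).hom) ⊗ₘ c = ((a ⊗ₘ b) ⊗ₘ c) ≫ (λ_ (𝟙_ C)).hom ▷ 𝟙_ C := by
    rw [← MonoidalCategory.tensorHom_id, MonoidalCategory.tensorHom_comp_tensorHom,
      Category.comp_id]
  have h2 : a ⊗ₘ ((b ⊗ₘ c) ≫ (λ_ (𝟙_ C)).hom) = (a ⊗ₘ (b ⊗ₘ c)) ≫ 𝟙_ C ◁ (λ_ (𝟙_ C)).hom := by
    rw [← MonoidalCategory.id_tensorHom, MonoidalCategory.tensorHom_comp_tensorHom,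
      Category.comp_id]
  rw [h1, h2, Category.assoc, Category.assoc, MonoidalCategory.leftUnitor_naturality,
    ← MonoidalCategory.associator_naturality_assoc, MonoidalCategory.leftUnitor_tensor_hom,
    Category.assoc, Iso.hom_inv_id_assoc]

/-- The unit operad `𝟙`, which is the tensor unit in arity one and zero in all other arities. -/
noncomputable def unit : Operad C where
  obj S _ := unitObj C S
  map {S T} _ _ _ := unitOut C S ≫ unitIn C T
  one := unitIn C (Fin 1)
  comp S T _ _ := (unitOut C (Option S) ⊗ₘ unitOut C T) ≫ (λ_ (𝟙_ C)).hom ≫ unitIn C (T ⊕ S)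
  map_refl S _ := unitOut_in C S
  map_trans {S T U} _ _ _ e f := by
    by_cases hT : Nat.card T = 1
    · rw [Category.assoc, ← Category.assoc (unitIn C T), unitIn_out hT, Category.id_comp]
    · exact (isZero_unitObj C (by rwa [Nat.card_congr e])).eq_of_src _ _
  comp_natural {S S' T T'} _ _ _ _ e f := by
    by_cases hS : Nat.card (Option S) = 1
    · by_cases hT : Nat.card T = 1
      · have hS' : Nat.card (Option S') = 1 := by rw [← hS, Nat.card_congr (Equiv.optionCongr e)]
        have hT' : Nat.card T' = 1 := by rw [← hT, Nat.card_congr f]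
        have h0 : Nat.card (T ⊕ S) = 1 := by
          rw [Finite.card_option] at hS
          rw [Nat.card_sum]
          omega
        rw [← Category.assoc, MonoidalCategory.tensorHom_comp_tensorHom]
        simp only [Category.assoc]
        rw [unitIn_out hS', unitIn_out hT', Category.comp_id, Category.comp_id,
          ← Category.assoc (unitIn C (T ⊕ S)), unitIn_out h0, Category.id_comp]
      · exact (isZero_tensor_right (isZero_unitObj C hT) _).eq_of_src _ _
    · exact (isZero_tensor_left (isZero_unitObj C hS) _).eq_of_src _ _
  one_comp T _ := by
    by_cases hT : Nat.card T = 1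
    · have h1 : Nat.card (Fin 1) = 1 := by simp
      have h2 : Nat.card (Option (Fin 0)) = 1 := by simp
      have h3 : Nat.card (T ⊕ Fin 0) = 1 := by simp [Nat.card_sum, hT]
      have e : unitIn C (Fin 1) ≫ unitOut C (Fin 1) ≫ unitIn C (Option (Fin 0)) =
          unitIn C (Option (Fin 0)) := by
        rw [← Category.assoc, unitIn_out h1, Category.id_comp]
      rw [e]
      simp only [Category.assoc]
      rw [← Category.assoc (unitIn C (T ⊕ Fin 0)), unitIn_out h3, Category.id_comp,
        ← MonoidalCategory.tensorHom_id, ← Category.assoc,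
        MonoidalCategory.tensorHom_comp_tensorHom, unitIn_out h2, Category.id_comp,
        MonoidalCategory.id_tensorHom, MonoidalCategory.leftUnitor_naturality_assoc, unitOut_in,
        Category.comp_id]
    · exact (isZero_tensor_right (isZero_unitObj C hT) _).eq_of_src _ _
  comp_one S _ := by
    by_cases hS : Nat.card (Option S) = 1
    · have h1 : Nat.card (Fin 1) = 1 := by simp
      have h3 : Nat.card (Fin 1 ⊕ S) = 1 := by
        rw [Finite.card_option] at hS
        rw [Nat.card_sum, h1]
        omega
      simp only [Category.assoc]
      rw [← Category.assoc (unitIn C (Fin 1 ⊕ S)), unitIn_out h3, Category.id_comp,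
        ← MonoidalCategory.id_tensorHom, ← Category.assoc,
        MonoidalCategory.tensorHom_comp_tensorHom, unitIn_out h1, Category.id_comp,
        MonoidalCategory.tensorHom_id, unitors_equal, MonoidalCategory.rightUnitor_naturality_assoc,
        unitOut_in, Category.comp_id]
    · exact (isZero_tensor_left (isZero_unitObj C hS) _).eq_of_src _ _
  assoc S T U _ _ _ := by
    by_cases hS : Nat.card (Option S) = 1
    · by_cases hT : Nat.card (Option T) = 1
      · by_cases hU : Nat.card U = 1
        · rw [Finite.card_option] at hS hT
          have h1 : Nat.card (Option T ⊕ S) = 1 := by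
            rw [Nat.card_sum, Finite.card_option]
            omega
          have h2 : Nat.card (Option (T ⊕ S)) = 1 := by
            rw [Finite.card_option, Nat.card_sum]
            omega
          have h3 : Nat.card (U ⊕ T) = 1 := by
            rw [Nat.card_sum]
            omega
          have h4 : Nat.card ((U ⊕ T) ⊕ S) = 1 := by
            rw [Nat.card_sum, Nat.card_sum]
            omega
          simp only [Category.assoc]
          rw [← Category.assoc (unitIn C (Option T ⊕ S)), unitIn_out h1, Category.id_comp,
            ← Category.assoc (unitIn C ((U ⊕ T) ⊕ S)), unitIn_out h4, Category.id_comp,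
            ← MonoidalCategory.tensorHom_id, ← MonoidalCategory.id_tensorHom, ← Category.assoc,
            MonoidalCategory.tensorHom_comp_tensorHom, Category.id_comp]
          simp only [Category.assoc]
          rw [unitIn_out h2, Category.comp_id,
            ← Category.assoc (𝟙 (unitObj C (Option S)) ⊗ₘ _),
            MonoidalCategory.tensorHom_comp_tensorHom]
          simp only [Category.assoc, Category.id_comp]
          rw [unitIn_out h3, Category.comp_id, ← Category.assoc, unit_assoc_aux]
          simp only [Category.assoc]
        · exact (isZero_tensor_right (isZero_unitObj C hU) _).eq_of_src _ _
      · exact (isZero_tensor_left (isZero_tensor_right (isZero_unitObj C hT) _) _).eq_of_src _ _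
    · exact (isZero_tensor_left (isZero_tensor_left (isZero_unitObj C hS) _) _).eq_of_src _ _
  comm S T U _ _ _ := by
    have hS : Nat.card (Option (Option S)) ≠ 1 := by
      rw [Finite.card_option, Finite.card_option]
      omega
    exact (isZero_tensor_left (isZero_tensor_left (isZero_unitObj C hS) _) _).eq_of_src _ _

end Unit

section Coalgebras

variable {C : Type u} [Category.{v} C] [MonoidalCategory C] [SymmetricCategory C]

/-- The tensor power `V ⊗ (V ⊗ (⋯ ⊗ 𝟙))`. -/
def tpow (V : C) : ℕ → C
  | 0 => 𝟙_ C
  | n + 1 => V ⊗ tpow V n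

/-- The tensor power of a morphism. -/
def tpowMap {V W : C} (f : V ⟶ W) : (n : ℕ) → (tpow V n ⟶ tpow W n)
  | 0 => 𝟙 (𝟙_ C)
  | n + 1 => f ⊗ₘ tpowMap f n

/-- The automorphism of `tpow V (n + 1)` exchanging the adjacent factors `i` and `i + 1`. -/
def tpowSwap (V : C) : (n : ℕ) → Fin n → (tpow V (n + 1) ⟶ tpow V (n + 1))
  | 0, i => i.elim0
  | n + 1, i => Fin.cases
      ((α_ V V (tpow V n)).inv ≫ (β_ V V).hom ▷ tpow V n ≫ (α_ V V (tpow V n)).hom)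
      (fun j => V ◁ tpowSwap V n j) i

/-- The canonical isomorphism given by concatenation, the first `n` factors being put before the last `m`. -/
def tpowConcat (V : C) : (n m : ℕ) → (tpow V n ⊗ tpow V m ⟶ tpow V (m + n))
  | 0, m => (λ_ (tpow V m)).hom
  | n + 1, m => (α_ V (tpow V n) (tpow V m)).hom ≫ V ◁ tpowConcat V n m

/-- The order preserving bijection from `Fin n ⊔ Fin m`, where `Fin n` is put before `Fin m`. -/
def concatEquiv (n m : ℕ) : Fin n ⊕ Fin m ≃ Fin (m + n) :=
  finSumFinEquiv.trans (finCongr (Nat.add_comm n m))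

/-- A coalgebra over an operad `P`: an object `V` with maps `P(n) ⊗ V ⟶ V^{⊗ n}` which are
equivariant (this is stated for the adjacent transpositions, which generate the
symmetric groups), compatible with the unit, and compatible with compositions: the cooperation of
the insertion of `q` in the first input of `p` is obtained by first applying the cooperation of `p`,
and then the cooperation of `q` to the first factor of the result. -/
structure Coalg (P : Operad C) where
  V : C
  δ (n : ℕ) : P.obj (Fin n) ⊗ V ⟶ tpow V n
  equivariant (n : ℕ) (i : Fin n) :
    P.map (Equiv.swap i.castSucc i.succ) ▷ V ≫ δ (n + 1) = δ (n + 1) ≫ tpowSwap V n i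
  counit : P.one ▷ V ≫ δ 1 = (λ_ V).hom ≫ (ρ_ V).inv
  coassoc (m n : ℕ) :
    (P.comp (Fin m) (Fin n) ≫ P.map (concatEquiv n m)) ▷ V ≫ δ (m + n) =
      (β_ (P.obj (Option (Fin m))) (P.obj (Fin n))).hom ▷ V ≫
        (α_ (P.obj (Fin n)) (P.obj (Option (Fin m))) V).hom ≫
        P.obj (Fin n) ◁ (P.map (finSuccEquiv m).symm ▷ V ≫ δ (m + 1)) ≫
        (α_ (P.obj (Fin n)) V (tpow V m)).inv ≫ δ n ▷ tpow V m ≫ tpowConcat V n m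

namespace Coalg

variable {P : Operad C}

/-- Morphisms of coalgebras. -/
@[ext]
structure Hom (V W : Coalg P) where
  hom : V.V ⟶ W.V
  comm (n : ℕ) : V.δ n ≫ tpowMap hom n = P.obj (Fin n) ◁ hom ≫ W.δ n

lemma tpowMap_id (V : C) (n : ℕ) : tpowMap (𝟙 V) n = 𝟙 (tpow V n) := by
  induction n with
  | zero => rfl
  | succ n ih =>
    change 𝟙 V ⊗ₘ tpowMap (𝟙 V) n = 𝟙 (V ⊗ tpow V n)
    rw [ih, MonoidalCategory.id_tensorHom_id]

lemma tpowMap_comp {U V W : C} (f : U ⟶ V) (g : V ⟶ W) (n : ℕ) :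
    tpowMap (f ≫ g) n = tpowMap f n ≫ tpowMap g n := by
  induction n with
  | zero => exact (Category.id_comp (𝟙 (𝟙_ C))).symm
  | succ n ih =>
    change (f ≫ g) ⊗ₘ tpowMap (f ≫ g) n = (f ⊗ₘ tpowMap f n) ≫ (g ⊗ₘ tpowMap g n)
    rw [ih, MonoidalCategory.tensorHom_comp_tensorHom]

instance : Category (Coalg P) where
  Hom := Hom
  id V :=
    { hom := 𝟙 V.V
      comm := fun n => by rw [tpowMap_id]; simp }
  comp f g :=
    { hom := f.hom ≫ g.hom
      comm := fun n => by
        rw [tpowMap_comp, ← Category.assoc, f.comm, Category.assoc, g.comm,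
          MonoidalCategory.whiskerLeft_comp, Category.assoc] }

end Coalg

/-- The functor which forgets the coalgebra structure. -/
def forget (P : Operad C) : Coalg P ⥤ C where
  obj V := V.V
  map f := f.hom

/-- An operad `P` (for which cofree coalgebras exist) is sane if the counit
`Forget (Cofree X) ⟶ X` is an epimorphism for all `X`. -/
def IsSane (P : Operad C) [(forget P).IsLeftAdjoint] : Prop :=
  ∀ X : C, Epi ((Adjunction.ofIsLeftAdjoint (forget P)).counit.app X)

end Coalgebras

/-- An object `X` is dualisable if the internal hom `X^∨ = [X, 𝟙]` exists and the canonical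
map `X ⊗ X^∨ ⟶ [X, X]` is an isomorphism, i.e. `X ⊗ X^∨`, with the evaluation
`(X ⊗ X^∨) ⊗ X ≅ X ⊗ (X^∨ ⊗ X) ⟶ X ⊗ 𝟙 ≅ X`, has the universal property of `[X, X]`. -/
def IsDualisable {C : Type u} [Category.{v} C] [MonoidalCategory C] (X : C) : Prop :=
  ∃ (D : C) (ev : D ⊗ X ⟶ 𝟙_ C),
    (∀ T : C, Function.Bijective fun g : T ⟶ D => g ▷ X ≫ ev) ∧
    (∀ T : C, Function.Bijective fun g : T ⟶ X ⊗ D =>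
      g ▷ X ≫ (α_ X D X).hom ≫ X ◁ ev ≫ (ρ_ X).hom)

section DG

variable {A : Type u} [Category.{v} A] [Preadditive A]

/-- A morphism of chain complexes is a quasi-isomorphism if both complexes have homology objects and
it induces isomorphisms between them. -/
def IsQuasiIso {K L : ChainComplex A ℤ} (f : K ⟶ L) : Prop :=
  ∃ (_ : ∀ i, K.HasHomology i) (_ : ∀ i, L.HasHomology i), QuasiIso f

variable [MonoidalCategory A]
  [SymmetricCategory A] [MonoidalClosed A] [HasColimits A]

/-- A dg-operad is cofibrant if it has the left lifting property with respect to the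
morphisms of dg-operads which are both degree-wise epimorphisms and quasi-isomorphisms. -/
def IsCofibrant (P : Operad (ChainComplex A ℤ)) : Prop :=
  ∀ ⦃Q R : Operad (ChainComplex A ℤ)⦄ (p : Q ⟶ R),
    (∀ (S : Type) [Finite S] (k : ℤ), Epi ((p.app S).f k)) →
    (∀ (S : Type) [Finite S], IsQuasiIso (p.app S)) →
    ∀ f : P ⟶ R, ∃ l : P ⟶ Q, l ≫ p = f

end DG

end Operad

/-!
Let `adj` be the adjunction between coalgebras and complexes. A morphism `q` from (the complex
underlying) a coalgebra `V` to `X` factors through the counit at `X`, so `P` is sane as soon as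
every complex `X` receives an epimorphism from some `P`-coalgebra (`isSane_of_exists`). Coalgebras
can be restricted along morphisms of operads `P ⟶ Q` (`Coalg.pullback`), so it is enough to find
such coalgebras for a suitable operad `Q` which receives a morphism from `P`.

The main construction (`squareZero`) assumes that `P(0)` has a dual `D`. For a module `N` over the
monoid `P(1)` it provides a `P`-coalgebra structure on `D ⊞ N`. Coassociativity forces the
contraction of the first factor of the cooperation of `p ∈ P(n + 1)` with `w ∈ P(0)` to be the
cooperation of the operation in `P(n)` which is obtained by inserting `w` in the first input of `p`.
As maps to `D ⊗ Y` are the same as maps to `Y` out of the tensor product with `P(0)`, this determines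
the component in `D` of the first factor by recursion on `n`. For the component in `N` of the first
factor, all the other factors are put in `D`: the operation `p` becomes an element of `P(1)` when
operations without inputs are inserted in its other inputs, and this element acts on `N`. So `D` is
a subcoalgebra, and there are no terms with two factors in `N`, as in a square zero extension. All
the axioms are identities between maps to tensor products with first factor `D ⊞ N`. They are
checked by comparing the contractions with `P(0)` and the components in `N` (`ctr_ext`), which leads
to an induction on arities (`delta_swap`, `ins_delta`).

For `N` one takes a free module `P(1) ⊗ Z`, and the projection `D ⊞ N ⟶ N` is a split epimorphism. An
epimorphism `P(1) ⊗ Z ⟶ X` exists if the unit of `P` is a split monomorphism in degree zero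
(`exists_epi_tensor`): a retraction extends to a chain map from `P(1)` to the contractible complex
`disk 1`, with the tensor unit in the degrees `1` and `0`, and `disk 1` multiplies `disk 0` (the
degrees `0` and `-1`) to itself. As `disk 0` surjects onto the tensor unit, one can choose
`Z = disk 0 ⊗ X`. This proves `exists_coalg_epi`, and the third case of the theorem.

In the first case, this applies to the unit operad, for which the object of arity zero is zero. In
the second case, it applies to the operad `arityOne (disk 1)`, which is the algebra `disk 1` in arity
one and zero otherwise. This operad is acyclic, so its morphism to the zero operad is both a
degree-wise epimorphism and a quasi-isomorphism, and therefore a cofibrant `P` maps to it.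
-/

namespace Operad

/-! ### Insertion of operations in the first input -/

section Insertion

variable {C : Type u} [Category.{v} C] [MonoidalCategory C] [SymmetricCategory C]

/-- The two ways of reversing the order of three tensor factors by braidings agree. -/
lemma braiding_reverse (X Y Z : C) :
    (β_ X Y).hom ▷ Z ≫ (β_ (Y ⊗ X) Z).hom =
      (α_ X Y Z).hom ≫ X ◁ (β_ Y Z).hom ≫ (β_ X (Z ⊗ Y)).hom ≫ (α_ Z Y X).hom := by
  rw [BraidedCategory.braiding_tensor_left_hom, BraidedCategory.braiding_tensor_right_hom]
  simp only [Category.assoc, Iso.inv_hom_id, Category.comp_id]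
  rw [← BraidedCategory.yang_baxter X Y Z, Iso.hom_inv_id_assoc]

variable (P : Operad C)

lemma map_comp_map {S T U : Type} [Finite S] [Finite T] [Finite U] (e : S ≃ T) (f : T ≃ U) :
    P.map e ≫ P.map f = P.map (e.trans f) := (P.map_trans e f).symm

/-- The partial composition with the inserted operation written first: `q ⊗ p` is sent to the
operation obtained by inserting `q` in the input `none` of `p`. With this order of the factors,
sequential associativity involves no braiding. -/
def insert (T S : Type) [Finite T] [Finite S] : P.obj T ⊗ P.obj (Option S) ⟶ P.obj (T ⊕ S) :=
  (β_ _ _).hom ≫ P.comp S T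

lemma insert_natural {S S' T T' : Type} [Finite S] [Finite S'] [Finite T] [Finite T']
    (e : S ≃ S') (f : T ≃ T') :
    P.map f ▷ _ ≫ _ ◁ P.map (Equiv.optionCongr e) ≫ P.insert T' S' =
      P.insert T S ≫ P.map (Equiv.sumCongr f e) := by
  rw [insert, insert, Category.assoc, ← P.comp_natural e f, ← Category.assoc (_ ▷ _),
    ← MonoidalCategory.tensorHom_def, BraidedCategory.braiding_naturality_assoc]

lemma insert_map_left {S T T' : Type} [Finite S] [Finite T] [Finite T'] (f : T ≃ T') :
    P.map f ▷ _ ≫ P.insert T' S = P.insert T S ≫ P.map (Equiv.sumCongr f (Equiv.refl S)) := by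
  have := P.insert_natural (Equiv.refl S) f
  rwa [Equiv.optionCongr_refl, P.map_refl, whiskerLeft_id, Category.id_comp] at this

lemma insert_map_right {S S' T : Type} [Finite S] [Finite S'] [Finite T] (e : S ≃ S') :
    _ ◁ P.map (Equiv.optionCongr e) ≫ P.insert T S' =
      P.insert T S ≫ P.map (Equiv.sumCongr (Equiv.refl T) e) := by
  have := P.insert_natural e (Equiv.refl T)
  rwa [P.map_refl, id_whiskerRight, Category.id_comp] at this

lemma insert_assoc (S T U : Type) [Finite S] [Finite T] [Finite U] :
    P.insert U T ▷ P.obj (Option S) ≫ P.insert (U ⊕ T) S ≫ P.map (Equiv.sumAssoc U T S) =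
      (α_ _ _ _).hom ≫ P.obj U ◁ (P.insert (Option T) S ≫ P.map (optionSumEquiv T S)) ≫
        P.insert U (T ⊕ S) := by
  have h := P.assoc S T U
  simp only [insert, comp_whiskerRight, whiskerLeft_comp, Category.assoc] at h ⊢
  rw [BraidedCategory.braiding_naturality_left_assoc, reassoc_of% braiding_reverse, ← h,
    ← comp_whiskerRight_assoc, ← BraidedCategory.braiding_naturality_right_assoc,
    whiskerLeft_comp, Category.assoc]

lemma insert_comm (S T U : Type) [Finite S] [Finite T] [Finite U] :
    P.obj U ◁ (P.insert T (Option S) ≫ P.map (sumOptionEquiv T S)) ≫ P.insert U (T ⊕ S) =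
      (α_ _ _ _).inv ≫ (β_ _ _).hom ▷ _ ≫ (α_ _ _ _).hom ≫
        P.obj T ◁ (P.obj U ◁ P.map (optionSwapEquiv S) ≫ P.insert U (Option S) ≫
          P.map (sumOptionEquiv U S)) ≫ P.insert T (U ⊕ S) ≫ P.map (sumSwapEquiv T U S) := by
  have h := P.comm S T U
  have hb : ∀ X Y Z : C, X ◁ (β_ Y Z).hom ≫ (β_ X (Z ⊗ Y)).hom =
      (α_ X Y Z).inv ≫ (β_ X Y).hom ▷ Z ≫ (β_ (Y ⊗ X) Z).hom ≫ (α_ Z Y X).inv := by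
    intro X Y Z
    rw [reassoc_of% braiding_reverse]
    simp
  have hs : ∀ X Y Z : C, (β_ X Y).hom ▷ Z ≫ (β_ Y X).hom ▷ Z = 𝟙 _ := by
    intro X Y Z
    rw [← comp_whiskerRight, SymmetricCategory.symmetry, id_whiskerRight]
  simp only [insert, comp_whiskerRight, whiskerLeft_comp, Category.assoc] at h ⊢
  rw [BraidedCategory.braiding_naturality_right_assoc,
    BraidedCategory.braiding_naturality_right_assoc, h, reassoc_of% hb,
    Iso.inv_hom_id_assoc, ← BraidedCategory.braiding_naturality_left_assoc,
    ← comp_whiskerRight_assoc, SymmetricCategory.symmetry, id_whiskerRight, Category.id_comp]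
  rw [BraidedCategory.braiding_naturality_right_assoc,
    BraidedCategory.braiding_naturality_right_assoc,
    ← whiskerLeft_comp_assoc, BraidedCategory.braiding_naturality_right, whiskerLeft_comp_assoc,
    BraidedCategory.braiding_naturality_right_assoc, reassoc_of% hb, Iso.hom_inv_id_assoc,
    reassoc_of% hs]

/-- The insertion `P(n) ⊗ P(m + 1) ⟶ P(m + n)` in the first input, the inputs of the inserted
operation coming first. -/
def ins (n m : ℕ) : P.obj (Fin n) ⊗ P.obj (Fin (m + 1)) ⟶ P.obj (Fin (m + n)) :=
  P.obj (Fin n) ◁ P.map (finSuccEquiv m) ≫ P.insert (Fin n) (Fin m) ≫ P.map (concatEquiv n m)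

/-- The action of the transposition of the inputs `i` and `i + 1`. -/
def swap {n : ℕ} (i : Fin n) : P.obj (Fin (n + 1)) ⟶ P.obj (Fin (n + 1)) :=
  P.map (Equiv.swap i.castSucc i.succ)

/-- The insertion of an operation without inputs in the first input. -/
abbrev contract (n : ℕ) : P.obj (Fin 0) ⊗ P.obj (Fin (n + 1)) ⟶ P.obj (Fin n) := P.ins 0 n

lemma ins_map_left (n m : ℕ) (e : Fin n ≃ Fin n) (f : Fin (m + n) ≃ Fin (m + n))
    (h : (Equiv.sumCongr e (Equiv.refl (Fin m))).trans (concatEquiv n m) =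
      (concatEquiv n m).trans f) :
    P.map e ▷ _ ≫ P.ins n m = P.ins n m ≫ P.map f := by
  simp only [ins, Category.assoc, map_comp_map]
  rw [← h, P.map_trans, ← whisker_exchange_assoc, reassoc_of% P.insert_map_left]

lemma ins_map_right (n m : ℕ) (e : Fin (m + 1) ≃ Fin (m + 1)) (e' : Fin m ≃ Fin m)
    (f : Fin (m + n) ≃ Fin (m + n))
    (he : e.trans (finSuccEquiv m) = (finSuccEquiv m).trans (Equiv.optionCongr e'))
    (h : (Equiv.sumCongr (Equiv.refl (Fin n)) e').trans (concatEquiv n m) =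
      (concatEquiv n m).trans f) :
    _ ◁ P.map e ≫ P.ins n m = P.ins n m ≫ P.map f := by
  simp only [ins, Category.assoc, map_comp_map]
  rw [← h, P.map_trans, ← whiskerLeft_comp_assoc, map_comp_map, he, P.map_trans,
    whiskerLeft_comp_assoc, reassoc_of% P.insert_map_right]

lemma concatEquiv_inl (n m : ℕ) (i : Fin n) : (concatEquiv n m (Sum.inl i)).val = i.val := by
  simp [concatEquiv]

lemma concatEquiv_inr (n m : ℕ) (i : Fin m) : (concatEquiv n m (Sum.inr i)).val = n + i.val := by
  simp [concatEquiv, add_comm]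

/-- Equality of bijections on values. -/
lemma equiv_fin_ext {T : Type} {n : ℕ} {e f : T ≃ Fin n} (h : ∀ x, (e x).val = (f x).val) :
    e = f :=
  Equiv.ext fun x => Fin.ext (h x)

lemma swap_val {n : ℕ} (i : Fin n) (x : Fin (n + 1)) :
    (Equiv.swap i.castSucc i.succ x).val =
      if x.val = i.val then i.val + 1 else if x.val = i.val + 1 then i.val else x.val := by
  rw [Equiv.swap_apply_def]
  simp only [Fin.ext_iff, Fin.val_castSucc, Fin.val_succ]
  split_ifs <;> simp

/-- The position of an element of `Option (Fin n)`, where `none` comes first. -/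
def optionVal {n : ℕ} (x : Option (Fin n)) : ℕ := x.elim 0 fun i => i.val + 1

lemma optionVal_finSuccEquiv {n : ℕ} (x : Fin (n + 1)) : optionVal (finSuccEquiv n x) = x.val := by
  refine Fin.cases ?_ (fun y => ?_) x <;> simp [optionVal]

lemma finSuccEquiv_symm_val {n : ℕ} (x : Option (Fin n)) :
    ((finSuccEquiv n).symm x).val = optionVal x := by
  rw [← optionVal_finSuccEquiv, Equiv.apply_symm_apply]

lemma equiv_option_ext {T : Type} {n : ℕ} {e f : T ≃ Option (Fin n)}
    (h : ∀ x, optionVal (e x) = optionVal (f x)) : e = f := by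
  ext x : 1
  rw [← (finSuccEquiv n).symm.injective.eq_iff, Fin.ext_iff, finSuccEquiv_symm_val,
    finSuccEquiv_symm_val, h]

lemma insert_finSucc (T : Type) [Finite T] (m : ℕ) :
    P.insert T (Fin (m + 1)) = _ ◁ P.map (Equiv.optionCongr (finSuccEquiv m)) ≫
      P.insert T (Option (Fin m)) ≫
        P.map (Equiv.sumCongr (Equiv.refl T) (finSuccEquiv m).symm) := by
  rw [reassoc_of% P.insert_map_right, map_comp_map]
  refine ((P.insert _ _ ≫= ?_).trans (Category.comp_id _)).symm
  rw [← P.map_refl]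
  congr 1
  ext (x | x) <;> simp

/-- Sequential associativity for insertions in the first inputs. -/
lemma ins_ins (l n m : ℕ) :
    P.ins l n ▷ _ ≫ P.ins (n + l) m =
      (α_ _ _ _).hom ≫ P.obj (Fin l) ◁ P.ins (n + 1) m ≫ P.ins l (m + n) ≫
        P.map (finCongr (add_assoc m n l)) := by
  have h1 : P.ins (n + 1) m ≫ P.map (finSuccEquiv (m + n)) =
      P.map (finSuccEquiv n) ▷ _ ≫ _ ◁ P.map (finSuccEquiv m) ≫
        (P.insert (Option (Fin n)) (Fin m) ≫ P.map (optionSumEquiv (Fin n) (Fin m))) ≫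
          P.map (Equiv.optionCongr (concatEquiv n m)) := by
    rw [ins, ← whisker_exchange_assoc, Category.assoc, Category.assoc, Category.assoc,
      reassoc_of% P.insert_map_left]
    simp only [map_comp_map]
    congr 3
    apply equiv_option_ext
    rintro (x | x)
    · simp only [Equiv.trans_apply, optionVal_finSuccEquiv, concatEquiv_inl]
      refine Fin.cases ?_ (fun y => ?_) x
      · simp [optionSumEquiv, optionVal]
      · simp [optionSumEquiv, optionVal, concatEquiv_inl]
    · simp only [Equiv.trans_apply, optionVal_finSuccEquiv, concatEquiv_inr]
      simp [optionSumEquiv, optionVal, concatEquiv_inr]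
      omega
  rw [ins.eq_def P l (m + n), Category.assoc, Category.assoc, ← whiskerLeft_comp_assoc, h1,
    ← Category.assoc (P.map (finSuccEquiv n) ▷ _), ← Category.assoc (_ ≫ _) (P.insert _ _ ≫ _),
    whiskerLeft_comp_assoc, reassoc_of% P.insert_map_right, whiskerLeft_comp, Category.assoc,
    whiskerLeft_comp, Category.assoc, ← associator_naturality_middle_assoc,
    ← associator_naturality_right_assoc, ← reassoc_of% P.insert_assoc]
  rw [ins, ins, comp_whiskerRight, comp_whiskerRight]
  simp only [Category.assoc]
  rw [← whisker_exchange_assoc, reassoc_of% P.insert_map_left, ← whisker_exchange_assoc]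
  simp only [map_comp_map]
  congr 5
  apply equiv_fin_ext
  rintro ((x | x) | x) <;> simp [concatEquiv_inl, concatEquiv_inr]
  omega

lemma contract_swap_succ (n : ℕ) (i : Fin n) :
    _ ◁ P.swap i.succ ≫ P.contract (n + 1) = P.contract (n + 1) ≫ P.swap i := by
  apply P.ins_map_right 0 (n + 1) _ (Equiv.swap i.castSucc i.succ)
  · apply equiv_option_ext
    intro x
    simp only [Equiv.trans_apply, optionVal_finSuccEquiv, swap_val]
    refine Fin.cases ?_ (fun y => ?_) x
    · rfl
    · simp only [finSuccEquiv_succ, optionVal, Equiv.optionCongr_apply, Option.map_some,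
        Option.elim_some, swap_val, Fin.val_succ]
      grind
  · apply equiv_fin_ext
    rintro (x | x)
    · exact x.elim0
    · simp only [Equiv.trans_apply, Equiv.sumCongr_apply, Sum.map_inr, concatEquiv_inr, swap_val,
        zero_add]

lemma swap_zero_ins (n m : ℕ) :
    P.swap (0 : Fin (n + 1)) ▷ _ ≫ P.ins (n + 2) m =
      P.ins (n + 2) m ≫ P.swap (0 : Fin (m + n + 1)) := by
  apply P.ins_map_left
  apply equiv_fin_ext
  rintro (x | x)
  · simp only [Equiv.trans_apply, Equiv.sumCongr_apply, Sum.map_inl, concatEquiv_inl]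
    rw [swap_val, swap_val, concatEquiv_inl]
    simp
  · simp only [Equiv.trans_apply, Equiv.sumCongr_apply, Sum.map_inr, concatEquiv_inr,
      Equiv.refl_apply]
    rw [swap_val, concatEquiv_inr]
    simp only [Fin.val_zero]
    grind

/-- Insertions in the first two inputs commute, up to exchanging these inputs. The bijection `e`
makes the second input of `p`, which follows the inputs of `q` in the insertion of `q` in `p`, the
first one. -/
lemma contract_ins (n m : ℕ) (e : Fin (m + 1 + n) ≃ Fin (m + n + 1))
    (he : ((Equiv.sumCongr (Equiv.refl (Fin n)) (finSuccEquiv m).symm).trans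
      ((concatEquiv n (m + 1)).trans e)).trans (finSuccEquiv (m + n)) =
        (sumOptionEquiv (Fin n) (Fin m)).trans (Equiv.optionCongr (concatEquiv n m))) :
    P.obj (Fin 0) ◁ (P.ins n (m + 1) ≫ P.map e) ≫ P.contract (m + n) =
      (α_ _ _ _).inv ≫ (β_ _ _).hom ▷ _ ≫ (α_ _ _ _).hom ≫
        P.obj (Fin n) ◁ (P.obj (Fin 0) ◁ P.swap 0 ≫ P.contract (m + 1)) ≫ P.ins n m := by
  have h1 : (P.ins n (m + 1) ≫ P.map e) ≫ P.map (finSuccEquiv (m + n)) =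
      _ ◁ P.map ((finSuccEquiv (m + 1)).trans (Equiv.optionCongr (finSuccEquiv m))) ≫
        (P.insert (Fin n) (Option (Fin m)) ≫ P.map (sumOptionEquiv (Fin n) (Fin m))) ≫
          P.map (Equiv.optionCongr (concatEquiv n m)) := by
    rw [ins, insert_finSucc, P.map_trans, whiskerLeft_comp]
    simp only [Category.assoc, map_comp_map]
    rw [← he]
    rfl
  have h3 : (Equiv.swap (0 : Fin (m + 1)).castSucc (0 : Fin (m + 1)).succ).trans
      ((finSuccEquiv (m + 1)).trans (Equiv.optionCongr (finSuccEquiv m))) =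
      ((finSuccEquiv (m + 1)).trans (Equiv.optionCongr (finSuccEquiv m))).trans
        (optionSwapEquiv (Fin m)) := by
    ext x : 1
    refine Fin.cases ?_ (fun y => Fin.cases ?_ (fun z => ?_) y) x
    · simp [optionSwapEquiv]
    · have h1 : finSuccEquiv (m + 1) 1 = some 0 := finSuccEquiv_succ 0
      simp [optionSwapEquiv, h1]
    · have hz : Equiv.swap (0 : Fin (m + 1)).castSucc (0 : Fin (m + 1)).succ z.succ.succ =
          z.succ.succ := Fin.ext (by rw [swap_val]; simp)
      rw [Equiv.trans_apply, hz]
      simp [optionSwapEquiv]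
  have h4 : (Equiv.sumCongr (Equiv.refl (Fin 0)) (finSuccEquiv m).symm).trans
      ((concatEquiv 0 (m + 1)).trans (finSuccEquiv m)) =
      (sumOptionEquiv (Fin 0) (Fin m)).trans (Equiv.optionCongr (concatEquiv 0 m)) := by
    apply equiv_option_ext
    rintro (x | (_ | x))
    · exact x.elim0
    · rfl
    · simp only [Equiv.trans_apply]
      erw [optionVal_finSuccEquiv]
  have h2 : (_ ◁ P.swap (0 : Fin (m + 1)) ≫ P.contract (m + 1)) ≫ P.map (finSuccEquiv m) =
      _ ◁ P.map ((finSuccEquiv (m + 1)).trans (Equiv.optionCongr (finSuccEquiv m))) ≫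
        (_ ◁ P.map (optionSwapEquiv (Fin m)) ≫ P.insert (Fin 0) (Option (Fin m)) ≫
          P.map (sumOptionEquiv (Fin 0) (Fin m))) ≫
          P.map (Equiv.optionCongr (concatEquiv 0 m)) := by
    rw [contract, ins, insert_finSucc, swap]
    simp only [Category.assoc, map_comp_map]
    rw [← whiskerLeft_comp_assoc, ← whiskerLeft_comp_assoc, map_comp_map, map_comp_map,
      Equiv.trans_assoc, Equiv.trans_assoc, h3, h4, P.map_trans _ (optionSwapEquiv _), whiskerLeft_comp_assoc]
  rw [contract, ins.eq_def P 0 (m + n), ← whiskerLeft_comp_assoc, h1, whiskerLeft_comp_assoc,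
    whiskerLeft_comp_assoc, reassoc_of% P.insert_map_right, reassoc_of% P.insert_comm]
  rw [ins.eq_def P n m, ← whiskerLeft_comp_assoc (P.obj (Fin n)) (_ ◁ P.swap 0 ≫ _), h2]
  simp only [whiskerLeft_comp, Category.assoc]
  erw [reassoc_of% P.insert_map_right (S' := Fin m) (concatEquiv 0 m)]
  rw [associator_inv_naturality_right_assoc, whisker_exchange_assoc,
    associator_naturality_right_assoc]
  simp only [map_comp_map]
  iterate 8 apply whisker_eq
  apply congrArg
  apply equiv_fin_ext
  rintro (x | (x | x))
  · simp [concatEquiv_inl, concatEquiv_inr, sumSwapEquiv]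
  · exact x.elim0
  · have h := concatEquiv_inr 0 m x
    simp only [zero_add] at h
    simp [concatEquiv_inr, sumSwapEquiv, h]

/-- Inserting operations without inputs in the first two inputs of an operation, in both orders. -/
lemma contract_contract (m : ℕ) :
    P.obj (Fin 0) ◁ P.contract (m + 1) ≫ P.contract m =
      (α_ _ _ _).inv ≫ (β_ _ _).hom ▷ _ ≫ (α_ _ _ _).hom ≫
        P.obj (Fin 0) ◁ (P.obj (Fin 0) ◁ P.swap 0 ≫ P.contract (m + 1)) ≫ P.contract m := by
  have h := P.contract_ins 0 m (Equiv.refl _) (by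
    apply equiv_option_ext
    rintro (x | (_ | x))
    · exact x.elim0
    · rfl
    · simp only [Equiv.trans_apply]
      erw [optionVal_finSuccEquiv])
  refine Eq.trans ?_ h
  congr 2
  erw [P.map_refl, Category.comp_id]

/-- The second input of the insertion of `q ∈ P(1)` in `p` is the second input of `p`. -/
lemma contract_ins_one (m : ℕ) :
    P.obj (Fin 0) ◁ (P.ins 1 (m + 1) ≫ P.swap 0) ≫ P.contract (m + 1) =
      (α_ _ _ _).inv ≫ (β_ _ _).hom ▷ _ ≫ (α_ _ _ _).hom ≫
        P.obj (Fin 1) ◁ (P.obj (Fin 0) ◁ P.swap 0 ≫ P.contract (m + 1)) ≫ P.ins 1 m := by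
  refine P.contract_ins 1 m _ ?_
  apply equiv_option_ext
  intro x
  simp only [Equiv.trans_apply]
  rw [optionVal_finSuccEquiv, swap_val]
  rcases x with (x | (_ | x)) <;> simp [concatEquiv_inl, concatEquiv_inr, sumOptionEquiv, optionVal]
  omega

/-- The first input of the insertion of `q` in `p` is the first input of `q`. -/
lemma contract_ins_succ (n m : ℕ) :
    P.contract n ▷ _ ≫ P.ins n m =
      (α_ _ _ _).hom ≫ P.obj (Fin 0) ◁ P.ins (n + 1) m ≫ P.contract (m + n) := by
  refine (P.ins_ins 0 n m).trans ?_
  congr 2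
  erw [P.map_refl, Category.comp_id]

/-- The multiplication of `P(1)`, where `q ⊗ p` is sent to the insertion of `q` in `p`. -/
abbrev mulOne : P.obj (Fin 1) ⊗ P.obj (Fin 1) ⟶ P.obj (Fin 1) := P.ins 1 0

lemma mulOne_ins (m : ℕ) :
    P.mulOne ▷ _ ≫ P.ins 1 m = (α_ _ _ _).hom ≫ P.obj (Fin 1) ◁ P.ins 1 m ≫ P.ins 1 m := by
  refine (P.ins_ins 1 0 m).trans ?_
  congr 2
  erw [P.map_refl, Category.comp_id]
  rfl

lemma one_ins (m : ℕ) : P.one ▷ _ ≫ P.ins 1 m = (λ_ (P.obj (Fin (m + 1)))).hom := by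
  have h := P.comp_one (Fin m)
  rw [ins, ← whisker_exchange_assoc, insert, Category.assoc,
    BraidedCategory.braiding_naturality_left_assoc]
  have h2 : concatEquiv 1 m = (finOneSumEquiv (Fin m)).trans (finSuccEquiv m).symm := by
    apply equiv_fin_ext
    rintro (x | x)
    · simp [concatEquiv_inl, finOneSumEquiv]
    · simp [concatEquiv_inr, finOneSumEquiv, add_comm]
  rw [h2, P.map_trans, reassoc_of% h, braiding_tensorUnit_left]
  simp only [Category.assoc, Iso.inv_hom_id_assoc]
  rw [leftUnitor_naturality_assoc, map_comp_map, Equiv.self_trans_symm, P.map_refl,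
    Category.comp_id]

/-- Inserting in the identity. The bijection `e` only serves to identify `P(0 + n)` with `P(n)`. -/
lemma ins_one (n : ℕ) (e : Fin (0 + n) ≃ Fin n) (he : e = finCongr (zero_add n)) :
    _ ◁ P.one ≫ P.ins n 0 ≫ P.map e = (ρ_ (P.obj (Fin n))).hom := by
  have h := P.one_comp (Fin n)
  have h2 : Equiv.sumEmpty (Fin n) (Fin 0) = (concatEquiv n 0).trans e := by
    subst he
    apply equiv_fin_ext
    rintro (x | x)
    · simp [concatEquiv_inl]
    · exact x.elim0
  rw [h2] at h
  rw [ins, insert]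
  simp only [Category.assoc, map_comp_map]
  rw [← whiskerLeft_comp_assoc, BraidedCategory.braiding_naturality_right_assoc, h,
    braiding_tensorUnit_right]
  simp

lemma contract_one : _ ◁ P.one ≫ P.contract 0 = (ρ_ (P.obj (Fin 0))).hom := by
  refine Eq.trans ?_ (P.ins_one 0 (Equiv.refl _) rfl)
  erw [P.map_refl, Category.comp_id]

lemma swap_braid (n : ℕ) :
    P.swap (1 : Fin (n + 2)) ≫ P.swap (0 : Fin (n + 2)) ≫ P.swap (1 : Fin (n + 2)) =
    P.swap (0 : Fin (n + 2)) ≫ P.swap (1 : Fin (n + 2)) ≫ P.swap (0 : Fin (n + 2)) := by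
  simp only [swap, map_comp_map]
  congr 1
  apply equiv_fin_ext
  intro x
  simp only [Equiv.trans_apply]
  iterate 6 rw [swap_val]
  simp only [Fin.val_zero, Fin.val_one]
  grind

lemma swap_comm (n : ℕ) (i : Fin n) :
    P.swap (0 : Fin (n + 2)) ≫ P.swap i.succ.succ =
    P.swap i.succ.succ ≫ P.swap (0 : Fin (n + 2)) := by
  simp only [swap, map_comp_map]
  congr 1
  apply equiv_fin_ext
  intro x
  simp only [Equiv.trans_apply]
  iterate 4 rw [swap_val]
  simp only [Fin.val_zero, Fin.val_succ]
  grind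

lemma swap_swap {n : ℕ} (i : Fin n) : P.swap i ≫ P.swap i = 𝟙 _ := by
  rw [swap, map_comp_map, ← P.map_refl]
  congr 1
  ext x
  simp

end Insertion

/-! ### Contractions with a dual object -/

section Contraction

section

variable {C : Type u} [Category.{v} C] [MonoidalCategory C] {W D : C} [ExactPairing D W]

/-- The contraction of the first factor of `D ⊗ Y` with the dual object `W`. -/
def ctrDual (Y : C) : W ⊗ (D ⊗ Y) ⟶ Y :=
  (α_ W D Y).inv ≫ (ε_ D W) ▷ Y ≫ (λ_ Y).hom

lemma ctrDual_natural {Y Y' : C} (g : Y ⟶ Y') :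
    W ◁ (D ◁ g) ≫ ctrDual Y' = ctrDual Y ≫ g := by
  simp only [ctrDual, Category.assoc, associator_inv_naturality_right_assoc,
    whisker_exchange_assoc, leftUnitor_naturality]

lemma ctrDual_tensor (Y Z : C) :
    W ◁ (α_ D Y Z).hom ≫ ctrDual (Y ⊗ Z) = (α_ _ _ _).inv ≫ ctrDual Y ▷ Z := by
  simp only [ctrDual]
  monoidal

/-- Maps to `D ⊗ Y` are determined by their contraction. -/
lemma ctrDual_bijective (T Y : C) :
    Function.Bijective fun g : T ⟶ D ⊗ Y => W ◁ g ≫ ctrDual Y :=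
  (tensorLeftHomEquiv T D W Y).symm.bijective

end

variable {C : Type u} [Category.{v} C] [MonoidalCategory C] [SymmetricCategory C]

/-- A map `W ⊗ Y' ⟶ Y` turned into a map `W ⊗ (X ⊗ Y') ⟶ X ⊗ Y` by moving `W` past `X`. -/
def past {W Y Y' : C} (X : C) (f : W ⊗ Y' ⟶ Y) : W ⊗ (X ⊗ Y') ⟶ X ⊗ Y :=
  (α_ _ _ _).inv ≫ (β_ W X).hom ▷ Y' ≫ (α_ _ _ _).hom ≫ X ◁ f

lemma past_comp {W Y Y' Z : C} (X : C) (f : W ⊗ Y' ⟶ Y) (g : Y ⟶ Z) :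
    past X f ≫ X ◁ g = past X (f ≫ g) := by
  simp [past]

lemma whiskerLeft_past {W Y Y' Z : C} (X : C) (g : Z ⟶ Y') (f : W ⊗ Y' ⟶ Y) :
    W ◁ (X ◁ g) ≫ past X f = past X (W ◁ g ≫ f) := by
  simp only [past, whiskerLeft_comp, associator_inv_naturality_right_assoc,
    whisker_exchange_assoc, associator_naturality_right_assoc]

lemma past_natural {W X X' Y Y' : C} (h : X ⟶ X') (f : W ⊗ Y' ⟶ Y) :
    W ◁ (h ▷ Y') ≫ past X' f = past X f ≫ h ▷ Y := by
  simp only [past, Category.assoc, whisker_exchange, associator_inv_naturality_middle_assoc,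
    ← associator_naturality_left_assoc, ← comp_whiskerRight_assoc,
    BraidedCategory.braiding_naturality_right]

lemma past_tensor {W Y Y' : C} (X₁ X₂ : C) (f : W ⊗ Y' ⟶ Y) :
    past (X₁ ⊗ X₂) f ≫ (α_ _ _ _).hom = W ◁ (α_ _ _ _).hom ≫ past X₁ (past X₂ f) := by
  simp only [past, BraidedCategory.braiding_tensor_right_hom]
  simp only [comp_whiskerRight, whisker_assoc, Category.assoc, tensor_whiskerLeft,
    Iso.inv_hom_id, Category.comp_id, whiskerLeft_comp]
  monoidal

lemma past_whiskerRight {W Y Y' : C} (X : C) (f : W ⊗ Y' ⟶ Y) (Z : C) :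
    W ◁ (α_ X Y' Z).hom ≫ past X ((α_ _ _ _).inv ≫ f ▷ Z) =
      (α_ _ _ _).inv ≫ past X f ▷ Z ≫ (α_ _ _ _).hom := by
  simp only [past]
  monoidal

/-- The isomorphism moving the middle factor to the front. -/
def frontIso (X V Y : C) : X ⊗ (V ⊗ Y) ≅ V ⊗ (X ⊗ Y) :=
  (α_ _ _ _).symm ≪≫ whiskerRightIso (β_ X V) Y ≪≫ α_ _ _ _

lemma frontIso_hom (X V Y : C) : (frontIso X V Y).hom =
    (α_ _ _ _).inv ≫ (β_ X V).hom ▷ Y ≫ (α_ _ _ _).hom := rfl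

lemma frontIso_natural (X : C) {V V' : C} (f : V ⟶ V') (Y : C) :
    (frontIso X V Y).hom ≫ f ▷ (X ⊗ Y) = X ◁ (f ▷ Y) ≫ (frontIso X V' Y).hom := by
  simp only [frontIso_hom, Category.assoc]
  rw [← associator_naturality_left, ← comp_whiskerRight_assoc,
    ← BraidedCategory.braiding_naturality_right, comp_whiskerRight_assoc,
    associator_inv_naturality_middle_assoc]

variable {W D : C} [ExactPairing D W]

/-- Contracting `D` in `X ⊗ (D ⊗ Y)` amounts to contracting it after moving it to the front. -/
lemma past_ctrDual (X Y : C) :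
    W ◁ (frontIso X D Y).hom ≫ ctrDual (X ⊗ Y) =
      past X (ctrDual (D := D) Y) := by
  have h : W ◁ (β_ X D).hom ≫ (α_ W D X).inv ≫ ε_ D W ▷ X ≫ (λ_ X).hom =
      (α_ W X D).inv ≫ (β_ W X).hom ▷ D ≫ (α_ X W D).hom ≫ X ◁ ε_ D W ≫ (ρ_ X).hom := by
    have h1 : ε_ D W ▷ X ≫ (λ_ X).hom = (β_ (W ⊗ D) X).hom ≫ X ◁ ε_ D W ≫ (ρ_ X).hom := by
      rw [← BraidedCategory.braiding_naturality_left_assoc, braiding_tensorUnit_left]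
      simp
    rw [h1, BraidedCategory.braiding_tensor_left_hom]
    simp only [Category.assoc, Iso.inv_hom_id_assoc]
    rw [← whiskerLeft_comp_assoc, SymmetricCategory.symmetry, whiskerLeft_id, Category.id_comp]
  have h2 := congrArg (fun f => W ◁ (α_ X D Y).inv ≫ (α_ _ _ _).inv ≫ f ▷ Y) h
  simp only [ctrDual, past, frontIso_hom] at h2 ⊢
  refine Eq.trans ?_ (h2.trans ?_) <;> monoidal

end Contraction

section Pairs

variable {C : Type u} [Category.{v} C] [Preadditive C] [MonoidalCategory C] {W D N : C}
  [ExactPairing D W] [HasBinaryBiproduct D N]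

variable (W D N) in
/-- The contraction of the first factor of `(D ⊞ N) ⊗ Y` with `W`, which is zero on `N`. -/
noncomputable def ctr (Y : C) : W ⊗ ((D ⊞ N) ⊗ Y) ⟶ Y :=
  W ◁ ((biprod.fst : D ⊞ N ⟶ D) ▷ Y) ≫ ctrDual Y

lemma ctr_natural {Y Y' : C} (g : Y ⟶ Y') :
    W ◁ ((D ⊞ N) ◁ g) ≫ ctr W D N Y' = ctr W D N Y ≫ g := by
  simp only [ctr, Category.assoc]
  rw [← ctrDual_natural, ← whiskerLeft_comp_assoc, ← whiskerLeft_comp_assoc, whisker_exchange]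

lemma ctr_tensor (Y Z : C) :
    W ◁ (α_ (D ⊞ N) Y Z).hom ≫ ctr W D N (Y ⊗ Z) = (α_ _ _ _).inv ≫ ctr W D N Y ▷ Z := by
  simp only [ctr]
  rw [comp_whiskerRight, ← whiskerLeft_comp_assoc, ← associator_naturality_left,
    whiskerLeft_comp_assoc, ctrDual_tensor]
  monoidal

section

variable [MonoidalPreadditive C]

/-- Maps to `(D ⊞ N) ⊗ Y` are determined by their contraction and their component in `N ⊗ Y`. -/
lemma ctr_ext {T Y : C} {g g' : T ⟶ (D ⊞ N) ⊗ Y} (h : W ◁ g ≫ ctr W D N Y = W ◁ g' ≫ ctr W D N Y)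
    (h' : g ≫ (biprod.snd : D ⊞ N ⟶ N) ▷ Y = g' ≫ (biprod.snd : D ⊞ N ⟶ N) ▷ Y) : g = g' := by
  have h1 : g ≫ (biprod.fst : D ⊞ N ⟶ D) ▷ Y = g' ≫ (biprod.fst : D ⊞ N ⟶ D) ▷ Y := by
    apply (ctrDual_bijective (W := W) T Y).injective
    simpa [ctr] using h
  have key : ∀ f : T ⟶ (D ⊞ N) ⊗ Y,
      f = (f ≫ (biprod.fst : D ⊞ N ⟶ D) ▷ Y) ≫ (biprod.inl : D ⟶ D ⊞ N) ▷ Y +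
        (f ≫ (biprod.snd : D ⊞ N ⟶ N) ▷ Y) ≫ (biprod.inr : N ⟶ D ⊞ N) ▷ Y := by
    intro f
    rw [Category.assoc, Category.assoc, ← comp_whiskerRight, ← comp_whiskerRight,
      ← Preadditive.comp_add, ← MonoidalPreadditive.add_whiskerRight, biprod.total,
      id_whiskerRight, Category.comp_id]
  rw [key g, key g', h1, h']

/-- There is a map to `(D ⊞ N) ⊗ Y` with prescribed contraction and component in `N ⊗ Y`. -/
lemma exists_ctr_eq {T Y : C} (f : W ⊗ T ⟶ Y) (f' : T ⟶ N ⊗ Y) :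
    ∃ g : T ⟶ (D ⊞ N) ⊗ Y, W ◁ g ≫ ctr W D N Y = f ∧
      g ≫ (biprod.snd : D ⊞ N ⟶ N) ▷ Y = f' := by
  obtain ⟨g, hg⟩ := (ctrDual_bijective (D := D) T Y).surjective f
  refine ⟨g ≫ biprod.inl ▷ Y + f' ≫ biprod.inr ▷ Y, ?_, ?_⟩
  · rw [ctr, ← whiskerLeft_comp_assoc, Preadditive.add_comp, Category.assoc, Category.assoc,
      ← comp_whiskerRight, ← comp_whiskerRight, biprod.inl_fst, biprod.inr_fst]
    simpa using hg
  · rw [Preadditive.add_comp, Category.assoc, Category.assoc,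
      ← comp_whiskerRight, ← comp_whiskerRight, biprod.inl_snd, biprod.inr_snd]
    simp

/-- The map to `(D ⊞ N) ⊗ Y` with prescribed contraction and component in `N ⊗ Y`. -/
noncomputable def pair {T Y : C} (f : W ⊗ T ⟶ Y) (f' : T ⟶ N ⊗ Y) : T ⟶ (D ⊞ N) ⊗ Y :=
  (exists_ctr_eq f f').choose

lemma pair_ctr {T Y : C} (f : W ⊗ T ⟶ Y) (f' : T ⟶ N ⊗ Y) :
    W ◁ pair f f' ≫ ctr W D N Y = f :=
  (exists_ctr_eq f f').choose_spec.1

lemma pair_snd {T Y : C} (f : W ⊗ T ⟶ Y) (f' : T ⟶ N ⊗ Y) :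
    pair (D := D) f f' ≫ (biprod.snd : D ⊞ N ⟶ N) ▷ Y = f' :=
  (exists_ctr_eq f f').choose_spec.2

end

variable [SymmetricCategory C]

/-- Contracting `D ⊞ N` in `X ⊗ ((D ⊞ N) ⊗ Y)` amounts to contracting it after moving it to the
front. -/
lemma past_ctr (X Y : C) :
    W ◁ (frontIso X (D ⊞ N) Y).hom ≫ ctr W D N (X ⊗ Y) =
      past X (ctr W D N Y) := by
  rw [ctr, ctr, ← whiskerLeft_past, ← past_ctrDual, ← whiskerLeft_comp_assoc,
    ← whiskerLeft_comp_assoc, frontIso_natural]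

variable [MonoidalPreadditive C]

lemma past_ctr_ext {T X Y : C} {g g' : T ⟶ X ⊗ ((D ⊞ N) ⊗ Y)}
    (h : W ◁ g ≫ past X (ctr W D N Y) = W ◁ g' ≫ past X (ctr W D N Y))
    (h' : g ≫ X ◁ ((biprod.snd : D ⊞ N ⟶ N) ▷ Y) = g' ≫ X ◁ ((biprod.snd : D ⊞ N ⟶ N) ▷ Y)) :
    g = g' := by
  rw [← cancel_mono (frontIso X (D ⊞ N) Y).hom]
  apply ctr_ext (W := W)
  · simpa only [← past_ctr, ← whiskerLeft_comp_assoc, Category.assoc] using h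
  · rw [Category.assoc, Category.assoc, frontIso_natural, reassoc_of% h']

/-- The map to `X ⊗ ((D ⊞ N) ⊗ Y)` with prescribed contraction of the second factor which has no
component in `X ⊗ (N ⊗ Y)`. -/
noncomputable def pairPast {T X Y : C} (f : W ⊗ T ⟶ X ⊗ Y) : T ⟶ X ⊗ ((D ⊞ N) ⊗ Y) :=
  pair (D := D) (N := N) f 0 ≫ (frontIso X (D ⊞ N) Y).inv

lemma pairPast_ctr {T X Y : C} (f : W ⊗ T ⟶ X ⊗ Y) :
    W ◁ pairPast f ≫ past X (ctr W D N Y) = f := by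
  rw [← past_ctr, ← whiskerLeft_comp_assoc, pairPast, Category.assoc, Iso.inv_hom_id,
    Category.comp_id, pair_ctr]

lemma pairPast_snd {T X Y : C} (f : W ⊗ T ⟶ X ⊗ Y) :
    pairPast (D := D) f ≫ X ◁ ((biprod.snd : D ⊞ N ⟶ N) ▷ Y) = 0 := by
  rw [← cancel_mono (frontIso X N Y).hom, Category.assoc, ← frontIso_natural, pairPast,
    Category.assoc, Iso.inv_hom_id_assoc, pair_snd, zero_comp]

end Pairs

/-! ### Moving factors of a tensor product -/

section Front

section

variable {C : Type u} [Category.{v} C] [MonoidalCategory C]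

/-- A map `f : X ⊗ Y ⟶ Y'` applied to the first two factors of `X ⊗ (Y ⊗ Z)`. -/
def onLeft {X Y Y' : C} (f : X ⊗ Y ⟶ Y') (Z : C) : X ⊗ (Y ⊗ Z) ⟶ Y' ⊗ Z :=
  (α_ X Y Z).inv ≫ f ▷ Z

lemma onLeft_comp {X Y Y' Y'' : C} (f : X ⊗ Y ⟶ Y') (g : Y' ⟶ Y'') (Z : C) :
    onLeft f Z ≫ g ▷ Z = onLeft (f ≫ g) Z := by
  simp [onLeft]

lemma whiskerLeft_onLeft {X Y₀ Y Y' : C} (g : Y₀ ⟶ Y) (f : X ⊗ Y ⟶ Y') (Z : C) :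
    X ◁ (g ▷ Z) ≫ onLeft f Z = onLeft (X ◁ g ≫ f) Z := by
  simp [onLeft]

lemma onLeft_exchange_right {X Y Y' Z Z' : C} (f : X ⊗ Y ⟶ Y') (g : Z ⟶ Z') :
    X ◁ (Y ◁ g) ≫ onLeft f Z' = onLeft f Z ≫ Y' ◁ g := by
  rw [onLeft, onLeft, associator_inv_naturality_right_assoc, whisker_exchange, Category.assoc]

lemma onLeft_exchange_right_assoc {X Y Y' Z Z' T : C} (f : X ⊗ Y ⟶ Y') (g : Z ⟶ Z')
    (h : Y' ⊗ Z' ⟶ T) : X ◁ (Y ◁ g) ≫ onLeft f Z' ≫ h = onLeft f Z ≫ Y' ◁ g ≫ h := by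
  rw [← Category.assoc, onLeft_exchange_right, Category.assoc]

lemma onLeft_onLeft {W X X' Y Z Z' : C} {f : X ⊗ Y ⟶ Z} {g : W ⊗ Z ⟶ Z'} {c : W ⊗ X ⟶ X'}
    {f' : X' ⊗ Y ⟶ Z'} (h : W ◁ f ≫ g = onLeft c Y ≫ f') (N : C) :
    W ◁ onLeft f N ≫ onLeft g N = onLeft c (Y ⊗ N) ≫ onLeft f' N := by
  have h' := congrArg (fun f => W ◁ (α_ X Y N).inv ≫ (α_ _ _ _).inv ≫ f ▷ N) h
  simp only [onLeft] at h' ⊢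
  refine Eq.trans ?_ (h'.trans ?_) <;> monoidal

end

variable {C : Type u} [Category.{v} C] [MonoidalCategory C] [SymmetricCategory C]

lemma past_eq {W Y Y' : C} (X : C) (f : W ⊗ Y' ⟶ Y) :
    past X f = (frontIso W X Y').hom ≫ X ◁ f := by
  simp [past, frontIso_hom]

lemma frontIso_natural_left {X X' : C} (f : X ⟶ X') (V Y : C) :
    f ▷ (V ⊗ Y) ≫ (frontIso X' V Y).hom = (frontIso X V Y).hom ≫ V ◁ (f ▷ Y) := by
  simp only [frontIso_hom, Category.assoc]
  rw [← associator_naturality_middle, ← comp_whiskerRight_assoc,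
    ← BraidedCategory.braiding_naturality_left, comp_whiskerRight_assoc,
    associator_inv_naturality_left_assoc]

lemma frontIso_natural_right (X V : C) {Y Y' : C} (f : Y ⟶ Y') :
    X ◁ (V ◁ f) ≫ (frontIso X V Y').hom = (frontIso X V Y).hom ≫ V ◁ (X ◁ f) := by
  simp only [frontIso_hom, Category.assoc, associator_inv_naturality_right_assoc,
    whisker_exchange_assoc, associator_naturality_right]

lemma frontIso_frontIso (X V Y : C) :
    (frontIso X V Y).hom ≫ (frontIso V X Y).hom = 𝟙 _ := by
  simp only [frontIso_hom, Category.assoc, Iso.hom_inv_id_assoc]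
  rw [← comp_whiskerRight_assoc, SymmetricCategory.symmetry]
  simp

/-- Two successive maps moved past `X`, as one map moved past `X`. -/
lemma past_past {W W' Y Y' Y'' : C} (X : C) (f : W ⊗ Y' ⟶ Y) (g : W' ⊗ Y ⟶ Y'') :
    W' ◁ past X f ≫ past X g =
      (α_ _ _ _).inv ≫ past X ((α_ W' W Y').hom ≫ W' ◁ f ≫ g) := by
  simp only [past, BraidedCategory.braiding_tensor_left_hom, whiskerLeft_comp, Category.assoc]
  rw [associator_inv_naturality_right_assoc, whisker_exchange_assoc,
    associator_naturality_right_assoc]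
  monoidal

lemma past_braid {W W' Y Y' : C} (X : C) (f : (W' ⊗ W) ⊗ Y' ⟶ Y) :
    past X ((β_ W W').hom ▷ Y' ≫ f) = (β_ W W').hom ▷ (X ⊗ Y') ≫ past X f := by
  rw [past_eq, past_eq, ← Category.assoc, frontIso_natural_left, Category.assoc, whiskerLeft_comp]

/-- Exchanging two maps moved past `X`, when they may be exchanged before. -/
lemma past_exchange {W Y₀ Y₁ Y₂ Y : C} (X : C) {f : W ⊗ Y₀ ⟶ Y₁} {g : W ⊗ Y₁ ⟶ Y}
    {f' : W ⊗ Y₀ ⟶ Y₂} {g' : W ⊗ Y₂ ⟶ Y}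
    (h : W ◁ f ≫ g = (frontIso W W Y₀).hom ≫ W ◁ f' ≫ g') :
    W ◁ past X f ≫ past X g =
      (frontIso W W (X ⊗ Y₀)).hom ≫ W ◁ past X f' ≫ past X g' := by
  rw [past_past, past_past, h]
  simp only [frontIso_hom, Category.assoc, Iso.hom_inv_id_assoc]
  rw [past_braid]

lemma onLeft_frontIso {W Y₀ Y₁ Y₂ Y : C} {f : W ⊗ Y₀ ⟶ Y₁} {g : W ⊗ Y₁ ⟶ Y}
    {f' : W ⊗ Y₀ ⟶ Y₂} {g' : W ⊗ Y₂ ⟶ Y}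
    (h : W ◁ f ≫ g = (frontIso W W Y₀).hom ≫ W ◁ f' ≫ g') (Z : C) :
    W ◁ onLeft f Z ≫ onLeft g Z =
      (frontIso W W (Y₀ ⊗ Z)).hom ≫ W ◁ onLeft f' Z ≫ onLeft g' Z := by
  have h' := congrArg (fun f => W ◁ (α_ W Y₀ Z).inv ≫ (α_ _ _ _).inv ≫ f ▷ Z) h
  simp only [frontIso_hom, onLeft] at h' ⊢
  refine Eq.trans ?_ (h'.trans ?_) <;> monoidal

lemma past_onLeft {W X Y Y' Z Z' : C} {f : X ⊗ Y ⟶ Z} {g : W ⊗ Z ⟶ Z'} {c : W ⊗ Y ⟶ Y'}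
    {f' : X ⊗ Y' ⟶ Z'} (h : W ◁ f ≫ g = past X c ≫ f') (N : C) :
    W ◁ onLeft f N ≫ onLeft g N = past X (onLeft c N) ≫ onLeft f' N := by
  have h' := congrArg (fun f => W ◁ (α_ X Y N).inv ≫ (α_ _ _ _).inv ≫ f ▷ N) h
  simp only [onLeft, past] at h' ⊢
  refine Eq.trans ?_ (h'.trans ?_) <;> monoidal

lemma past_past_onLeft {W X M N Y Y' : C} (f : X ⊗ M ⟶ N) (h : W ⊗ Y' ⟶ Y) :
    W ◁ onLeft f Y' ≫ past N h = past X (past M h) ≫ onLeft f Y := by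
  rw [onLeft, whiskerLeft_comp, Category.assoc, past_natural, ← cancel_epi (W ◁ (α_ X M Y').hom),
    ← whiskerLeft_comp_assoc, Iso.hom_inv_id, whiskerLeft_id, Category.id_comp, onLeft,
    ← reassoc_of% past_tensor, Iso.hom_inv_id_assoc]

end Front

/-! ### Maps determined by contractions -/

section SquareZero

variable {C : Type u} [Category.{v} C] [Preadditive C] [MonoidalCategory C] [SymmetricCategory C]
  [MonoidalPreadditive C]

/-- Two successive contractions of `(D ⊞ N) ⊗ (D ⊞ N) ⊗ Y`, where the second factor is contracted
first. -/
lemma ctr_ctr {W D N : C} [ExactPairing D W] [HasBinaryBiproduct D N] {Y Y' : C}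
    (f : W ⊗ Y' ⟶ Y) :
    W ◁ past (D ⊞ N) f ≫ ctr W D N Y =
      (frontIso W W ((D ⊞ N) ⊗ Y')).hom ≫ W ◁ ctr W D N Y' ≫ f := by
  rw [past_eq, whiskerLeft_comp, Category.assoc, ctr_natural, reassoc_of% past_ctr, past_eq,
    Category.assoc]

section

variable {W D N : C} [ExactPairing D W] [HasBinaryBiproduct D N]

/-! The following lemmas concern maps which are given by their contractions, like the cooperations
below. They are stated for arbitrary objects `Y` in place of tensor powers, as
`tpow V (n + 1)` is `V ⊗ tpow V n` only after unfolding. -/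

/-- If the component in `N` of the second factor vanishes, and also after contracting that factor
and passing to the next one, then the component in `N` of the third factor vanishes. -/
lemma past_snd_snd {Y T₂ T₁ : C} {k₂ : T₂ ⟶ N ⊗ ((D ⊞ N) ⊗ ((D ⊞ N) ⊗ Y))}
    {k₁ : T₁ ⟶ N ⊗ ((D ⊞ N) ⊗ Y)} {c₂ : W ⊗ T₂ ⟶ T₁}
    (h₂ : W ◁ k₂ ≫ past N (ctr W D N ((D ⊞ N) ⊗ Y)) = c₂ ≫ k₁)
    (h₂' : k₂ ≫ N ◁ ((biprod.snd : D ⊞ N ⟶ N) ▷ ((D ⊞ N) ⊗ Y)) = 0)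
    (h₁' : k₁ ≫ N ◁ ((biprod.snd : D ⊞ N ⟶ N) ▷ Y) = 0) :
    k₂ ≫ N ◁ ((D ⊞ N) ◁ ((biprod.snd : D ⊞ N ⟶ N) ▷ Y)) = 0 := by
  apply past_ctr_ext (W := W)
  · rw [whiskerLeft_comp, Category.assoc, whiskerLeft_past, ctr_natural, ← past_comp,
      reassoc_of% h₂, h₁']
    simp
  · rw [zero_comp, Category.assoc, ← whiskerLeft_comp, whisker_exchange, whiskerLeft_comp,
      reassoc_of% h₂', zero_comp]

lemma comp_eq_comp_of_past {Y Y' T T' : C} {k : T ⟶ N ⊗ ((D ⊞ N) ⊗ Y)} {l : W ⊗ T ⟶ N ⊗ Y}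
    {k' : T' ⟶ N ⊗ ((D ⊞ N) ⊗ Y')} {l' : W ⊗ T' ⟶ N ⊗ Y'}
    (hk : W ◁ k ≫ past N (ctr W D N Y) = l) (hk' : W ◁ k' ≫ past N (ctr W D N Y') = l')
    (h : k ≫ N ◁ ((biprod.snd : D ⊞ N ⟶ N) ▷ Y) = 0)
    (h' : k' ≫ N ◁ ((biprod.snd : D ⊞ N ⟶ N) ▷ Y') = 0) (s : T ⟶ T') (g : Y ⟶ Y')
    (hl : W ◁ s ≫ l' = l ≫ N ◁ g) :
    s ≫ k' = k ≫ N ◁ ((D ⊞ N) ◁ g) := by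
  apply past_ctr_ext (W := W)
  · rw [whiskerLeft_comp, Category.assoc, hk', hl, whiskerLeft_comp, Category.assoc,
      whiskerLeft_past, ctr_natural, ← past_comp, reassoc_of% hk]
  · rw [Category.assoc, h', Category.assoc, ← whiskerLeft_comp, whisker_exchange, whiskerLeft_comp,
      reassoc_of% h, comp_zero, zero_comp]

lemma comp_eq_comp_of_ctr {Y Y' S S' : C} {d : S ⟶ (D ⊞ N) ⊗ Y} {l : W ⊗ S ⟶ Y}
    {d' : S' ⟶ (D ⊞ N) ⊗ Y'} {l' : W ⊗ S' ⟶ Y'} {p : S ⟶ N ⊗ Y} {p' : S' ⟶ N ⊗ Y'}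
    (hd : W ◁ d ≫ ctr W D N Y = l) (hd' : W ◁ d' ≫ ctr W D N Y' = l')
    (h : d ≫ (biprod.snd : D ⊞ N ⟶ N) ▷ Y = p) (h' : d' ≫ (biprod.snd : D ⊞ N ⟶ N) ▷ Y' = p')
    (s : S ⟶ S') (g : Y ⟶ Y') (hl : W ◁ s ≫ l' = l ≫ g) (hp : s ≫ p' = p ≫ N ◁ g) :
    s ≫ d' = d ≫ (D ⊞ N) ◁ g := by
  apply ctr_ext (W := W)
  · rw [whiskerLeft_comp, Category.assoc, hd', hl, whiskerLeft_comp, Category.assoc,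
      ctr_natural, reassoc_of% hd]
  · rw [Category.assoc, h', hp, Category.assoc, whisker_exchange, reassoc_of% h]

/-- Maps to `N ⊗ (D ⊞ N) ⊗ (D ⊞ N) ⊗ Y` obtained by two successive contractions are exchanged by
the symmetry if the contractions are. -/
lemma comp_frontIso_of_past {Y T₂ T₁ T₀ : C} {k₂ : T₂ ⟶ N ⊗ ((D ⊞ N) ⊗ ((D ⊞ N) ⊗ Y))}
    {k₁ : T₁ ⟶ N ⊗ ((D ⊞ N) ⊗ Y)} {k₀ : T₀ ⟶ N ⊗ Y} {c₂ : W ⊗ T₂ ⟶ T₁} {c₁ : W ⊗ T₁ ⟶ T₀}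
    (h₂ : W ◁ k₂ ≫ past N (ctr W D N ((D ⊞ N) ⊗ Y)) = c₂ ≫ k₁)
    (h₁ : W ◁ k₁ ≫ past N (ctr W D N Y) = c₁ ≫ k₀)
    (h₂' : k₂ ≫ N ◁ ((biprod.snd : D ⊞ N ⟶ N) ▷ ((D ⊞ N) ⊗ Y)) = 0)
    (h₁' : k₁ ≫ N ◁ ((biprod.snd : D ⊞ N ⟶ N) ▷ Y) = 0) (s : T₂ ⟶ T₂)
    (hs : W ◁ (W ◁ s ≫ c₂) ≫ c₁ = (frontIso W W T₂).hom ≫ W ◁ c₂ ≫ c₁) :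
    s ≫ k₂ = k₂ ≫ N ◁ (frontIso (D ⊞ N) (D ⊞ N) Y).hom := by
  have h := past_snd_snd h₂ h₂' h₁'
  have e : W ◁ (k₂ ≫ N ◁ (frontIso (D ⊞ N) (D ⊞ N) Y).hom) ≫
      past N (ctr W D N ((D ⊞ N) ⊗ Y)) = W ◁ k₂ ≫ past N (past (D ⊞ N) (ctr W D N Y)) := by
    rw [whiskerLeft_comp, Category.assoc, whiskerLeft_past, past_ctr]
  apply past_ctr_ext (W := W)
  · rw [e, whiskerLeft_comp, Category.assoc, h₂]
    apply past_ctr_ext (W := W)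
    · rw [whiskerLeft_comp, whiskerLeft_comp, whiskerLeft_comp, Category.assoc, Category.assoc, h₁,
        Category.assoc, past_exchange N (ctr_ctr (D := D) (N := N) (ctr W D N Y)),
        reassoc_of% frontIso_natural_right, ← whiskerLeft_comp_assoc W (W ◁ k₂), h₂,
        whiskerLeft_comp_assoc, h₁]
      have hs' := hs =≫ k₀
      simpa using hs'
    · rw [Category.assoc, Category.assoc, h₁', Category.assoc, past_comp, ← past_natural,
        ← whiskerLeft_past, ← whiskerLeft_comp_assoc, h₂']
      simp
  · rw [Category.assoc, h₂', Category.assoc, ← whiskerLeft_comp, frontIso_natural,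
      whiskerLeft_comp, reassoc_of% h]
    simp

/-- The symmetry of maps to `(D ⊞ N) ⊗ (D ⊞ N) ⊗ Y` which are given by their contractions and their
components in `N ⊗ (D ⊞ N) ⊗ Y`. -/
lemma comp_frontIso_of_ctr {Y S₂ S₁ S₀ T₁ T₀ : C} {d₂ : S₂ ⟶ (D ⊞ N) ⊗ ((D ⊞ N) ⊗ Y)}
    {d₁ : S₁ ⟶ (D ⊞ N) ⊗ Y} {d₀ : S₀ ⟶ Y} {e₂ : W ⊗ S₂ ⟶ S₁} {e₁ : W ⊗ S₁ ⟶ S₀}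
    {k₁ : T₁ ⟶ N ⊗ ((D ⊞ N) ⊗ Y)} {k₀ : T₀ ⟶ N ⊗ Y} {c₁ : W ⊗ T₁ ⟶ T₀}
    {p₂ : S₂ ⟶ T₁} {p₁ : S₁ ⟶ T₀}
    (hd₂ : W ◁ d₂ ≫ ctr W D N ((D ⊞ N) ⊗ Y) = e₂ ≫ d₁)
    (hd₁ : W ◁ d₁ ≫ ctr W D N Y = e₁ ≫ d₀)
    (hp₂ : d₂ ≫ (biprod.snd : D ⊞ N ⟶ N) ▷ ((D ⊞ N) ⊗ Y) = p₂ ≫ k₁)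
    (hp₁ : d₁ ≫ (biprod.snd : D ⊞ N ⟶ N) ▷ Y = p₁ ≫ k₀)
    (hk : W ◁ k₁ ≫ past N (ctr W D N Y) = c₁ ≫ k₀)
    (hk' : k₁ ≫ N ◁ ((biprod.snd : D ⊞ N ⟶ N) ▷ Y) = 0) (s : S₂ ⟶ S₂)
    (hss : s ≫ s = 𝟙 _)
    (hs : W ◁ (W ◁ s ≫ e₂) ≫ e₁ = (frontIso W W S₂).hom ≫ W ◁ e₂ ≫ e₁)
    (hc : W ◁ s ≫ e₂ ≫ p₁ = W ◁ p₂ ≫ c₁) :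
    s ≫ d₂ = d₂ ≫ (frontIso (D ⊞ N) (D ⊞ N) Y).hom := by
  apply ctr_ext (W := W)
  · rw [whiskerLeft_comp, Category.assoc, hd₂, whiskerLeft_comp, Category.assoc, past_ctr]
    apply ctr_ext (W := W)
    · rw [whiskerLeft_comp, whiskerLeft_comp, whiskerLeft_comp, Category.assoc, Category.assoc, hd₁,
        Category.assoc, ctr_ctr, reassoc_of% frontIso_natural_right,
        ← whiskerLeft_comp_assoc W (W ◁ d₂), hd₂, whiskerLeft_comp_assoc, hd₁]
      have := hs =≫ d₀
      simpa using this
    · rw [Category.assoc, Category.assoc, hp₁, reassoc_of% hc, Category.assoc, ← past_natural,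
        ← whiskerLeft_comp_assoc, hp₂, whiskerLeft_comp_assoc, hk]
  · rw [Category.assoc, Category.assoc, hp₂, frontIso_natural]
    have hc' : W ◁ s ≫ W ◁ p₂ ≫ c₁ = e₂ ≫ p₁ := by
      rw [← hc, ← whiskerLeft_comp_assoc, hss, whiskerLeft_id, Category.id_comp]
    apply past_ctr_ext (W := W)
    · rw [whiskerLeft_comp, whiskerLeft_comp, Category.assoc, Category.assoc, hk, reassoc_of% hc',
        ← hp₁, ← reassoc_of% hd₂, ← past_ctr, whiskerLeft_comp, whiskerLeft_comp, Category.assoc,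
        Category.assoc, ← whiskerLeft_comp_assoc W (frontIso _ _ _).hom, frontIso_frontIso,
        whiskerLeft_id, Category.id_comp, ctr_natural]
    · rw [Category.assoc, Category.assoc, hk', Category.assoc, Category.assoc,
        ← frontIso_natural_left, whisker_exchange_assoc, reassoc_of% hp₂, reassoc_of% hk']
      simp

lemma comp_eq_of_past {Y T T' S : C} {k : T ⟶ N ⊗ ((D ⊞ N) ⊗ Y)} {l : W ⊗ T ⟶ N ⊗ Y}
    {k' : T' ⟶ N ⊗ ((D ⊞ N) ⊗ Y)} {l' : W ⊗ T' ⟶ N ⊗ Y}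
    (hk : W ◁ k ≫ past N (ctr W D N Y) = l) (hk' : W ◁ k' ≫ past N (ctr W D N Y) = l')
    (h : k ≫ N ◁ ((biprod.snd : D ⊞ N ⟶ N) ▷ Y) = 0)
    (h' : k' ≫ N ◁ ((biprod.snd : D ⊞ N ⟶ N) ▷ Y) = 0) (f : S ⟶ T) (f' : S ⟶ T')
    (hl : W ◁ f ≫ l = W ◁ f' ≫ l') : f ≫ k = f' ≫ k' := by
  apply past_ctr_ext (W := W)
  · rw [whiskerLeft_comp, Category.assoc, hk, hl, whiskerLeft_comp, Category.assoc, hk']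
  · rw [Category.assoc, h, Category.assoc, h', comp_zero, comp_zero]

lemma comp_eq_of_ctr {Y T T' S : C} {d : T ⟶ (D ⊞ N) ⊗ Y} {l : W ⊗ T ⟶ Y} {p : T ⟶ N ⊗ Y}
    {d' : T' ⟶ (D ⊞ N) ⊗ Y} {l' : W ⊗ T' ⟶ Y} {p' : T' ⟶ N ⊗ Y}
    (hd : W ◁ d ≫ ctr W D N Y = l) (hd' : W ◁ d' ≫ ctr W D N Y = l')
    (h : d ≫ (biprod.snd : D ⊞ N ⟶ N) ▷ Y = p) (h' : d' ≫ (biprod.snd : D ⊞ N ⟶ N) ▷ Y = p')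
    (f : S ⟶ T) (f' : S ⟶ T') (hl : W ◁ f ≫ l = W ◁ f' ≫ l') (hp : f ≫ p = f' ≫ p') :
    f ≫ d = f' ≫ d' := by
  apply ctr_ext (W := W)
  · rw [whiskerLeft_comp, Category.assoc, hd, hl, whiskerLeft_comp, Category.assoc, hd']
  · rw [Category.assoc, h, hp, Category.assoc, h']

/-- If a map `k` is given by its contraction `l`, then it commutes with an action on `N` if `l`
does. -/
lemma comp_eq_onLeft_of_past {X Y T : C} (act : X ⊗ N ⟶ N) {k : T ⟶ N ⊗ ((D ⊞ N) ⊗ Y)}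
    {l : W ⊗ T ⟶ N ⊗ Y} (hk : W ◁ k ≫ past N (ctr W D N Y) = l)
    (h : k ≫ N ◁ ((biprod.snd : D ⊞ N ⟶ N) ▷ Y) = 0) (f : X ⊗ T ⟶ T)
    (hl : W ◁ f ≫ l = past X l ≫ onLeft act Y) :
    f ≫ k = X ◁ k ≫ onLeft act ((D ⊞ N) ⊗ Y) := by
  apply past_ctr_ext (W := W)
  · rw [whiskerLeft_comp, Category.assoc, hk, hl, whiskerLeft_comp, Category.assoc,
      past_past_onLeft, ← hk, reassoc_of% whiskerLeft_past]
  · rw [Category.assoc, h, comp_zero, Category.assoc, ← onLeft_exchange_right,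
      ← whiskerLeft_comp_assoc, h]
    simp

lemma onLeft_past_ctr {X X' M Y Y' Z : C} {k : X ⊗ M ⟶ N ⊗ ((D ⊞ N) ⊗ Y)} {c : W ⊗ X ⟶ X'}
    {k₀ : X' ⊗ M ⟶ N ⊗ Y} (hk : W ◁ k ≫ past N (ctr W D N Y) = onLeft c M ≫ k₀)
    (g : Y ⊗ Z ⟶ Y') :
    W ◁ (onLeft k Z ≫ (α_ _ _ _).hom ≫ N ◁ ((α_ _ _ _).hom ≫ (D ⊞ N) ◁ g)) ≫
      past N (ctr W D N Y') = onLeft c (M ⊗ Z) ≫ onLeft k₀ Z ≫ (α_ _ _ _).hom ≫ N ◁ g := by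
  have h1 : W ◁ (α_ N ((D ⊞ N) ⊗ Y) Z).hom ≫
      W ◁ (N ◁ ((α_ _ _ _).hom ≫ (D ⊞ N) ◁ g)) ≫ past N (ctr W D N Y') =
      (α_ _ _ _).inv ≫ past N (ctr W D N Y) ▷ Z ≫ (α_ _ _ _).hom ≫ N ◁ g := by
    rw [whiskerLeft_past, whiskerLeft_comp, Category.assoc, ctr_natural, ← Category.assoc,
      ctr_tensor, ← past_comp, reassoc_of% past_whiskerRight]
  rw [whiskerLeft_comp, whiskerLeft_comp, Category.assoc, Category.assoc, h1]
  have h2 := congrArg (fun f => W ◁ (α_ X M Z).inv ≫ (α_ _ _ _).inv ≫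
    f ▷ Z ≫ (α_ _ _ _).hom ≫ N ◁ g) hk
  simp only [onLeft] at h2 ⊢
  refine Eq.trans ?_ (h2.trans ?_) <;> monoidal

lemma onLeft_past_snd {X M Y Y' Z : C} {k : X ⊗ M ⟶ N ⊗ ((D ⊞ N) ⊗ Y)}
    (hk : k ≫ N ◁ ((biprod.snd : D ⊞ N ⟶ N) ▷ Y) = 0) (g : Y ⊗ Z ⟶ Y') :
    (onLeft k Z ≫ (α_ _ _ _).hom ≫ N ◁ ((α_ _ _ _).hom ≫ (D ⊞ N) ◁ g)) ≫
      N ◁ ((biprod.snd : D ⊞ N ⟶ N) ▷ Y') = 0 := by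
  have h2 := congrArg (fun f => (α_ X M Z).inv ≫ f ▷ Z ≫ (α_ _ _ _).hom ≫
    N ◁ ((α_ _ _ _).hom ≫ N ◁ g)) hk
  simp only [MonoidalPreadditive.zero_whiskerRight, zero_comp, comp_zero] at h2
  rw [← h2, onLeft]
  simp only [Category.assoc, ← whiskerLeft_comp, whisker_exchange]
  monoidal

lemma onLeft_ctr {X X' M Y Y' Z : C} {d : X ⊗ M ⟶ (D ⊞ N) ⊗ Y} {c : W ⊗ X ⟶ X'}
    {d₀ : X' ⊗ M ⟶ Y} (hd : W ◁ d ≫ ctr W D N Y = onLeft c M ≫ d₀) (g : Y ⊗ Z ⟶ Y') :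
    W ◁ (onLeft d Z ≫ (α_ _ _ _).hom ≫ (D ⊞ N) ◁ g) ≫ ctr W D N Y' =
      onLeft c (M ⊗ Z) ≫ onLeft d₀ Z ≫ g := by
  rw [whiskerLeft_comp, whiskerLeft_comp, Category.assoc, Category.assoc, ctr_natural,
    reassoc_of% ctr_tensor]
  have h2 := congrArg (fun f => W ◁ (α_ X M Z).inv ≫ (α_ _ _ _).inv ≫ f ▷ Z ≫ g) hd
  simp only [onLeft] at h2 ⊢
  refine Eq.trans ?_ (h2.trans ?_) <;> monoidal

lemma onLeft_snd {X M M' Y Y' Z : C} {d : X ⊗ M ⟶ (D ⊞ N) ⊗ Y} {p : M ⟶ M'}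
    {k : X ⊗ M' ⟶ N ⊗ Y} (hd : d ≫ (biprod.snd : D ⊞ N ⟶ N) ▷ Y = X ◁ p ≫ k)
    (g : Y ⊗ Z ⟶ Y') :
    (onLeft d Z ≫ (α_ _ _ _).hom ≫ (D ⊞ N) ◁ g) ≫ (biprod.snd : D ⊞ N ⟶ N) ▷ Y' =
      X ◁ (p ▷ Z) ≫ onLeft k Z ≫ (α_ _ _ _).hom ≫ N ◁ g := by
  have h2 := congrArg (fun f => (α_ X M Z).inv ≫ f ▷ Z ≫ (α_ _ _ _).hom ≫ N ◁ g) hd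
  simp only [onLeft, Category.assoc, whisker_exchange] at h2 ⊢
  refine Eq.trans ?_ (h2.trans ?_) <;> monoidal

end

end SquareZero

/-! ### The coalgebra structure on the sum of a dual of `P(0)` and a `P(1)`-module -/

section SquareZero

section

variable {C : Type u} [Category.{v} C] [MonoidalCategory C] [SymmetricCategory C]
  (P : Operad C)

/-- The insertion of an operation without inputs in the second input. -/
def contractSnd (n : ℕ) : P.obj (Fin 0) ⊗ P.obj (Fin (n + 2)) ⟶ P.obj (Fin (n + 1)) :=
  P.obj (Fin 0) ◁ P.swap 0 ≫ P.contract (n + 1)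

lemma swap_contractSnd (n : ℕ) (i : Fin n) :
    P.obj (Fin 0) ◁ P.swap i.succ.succ ≫ P.contractSnd (n + 1) =
      P.contractSnd (n + 1) ≫ P.swap i.succ := by
  rw [contractSnd, ← whiskerLeft_comp_assoc]
  erw [← P.swap_comm]
  rw [whiskerLeft_comp_assoc, P.contract_swap_succ, Category.assoc]

lemma contractSnd_ins (n m : ℕ) :
    P.obj (Fin 0) ◁ P.ins (n + 2) m ≫ P.contractSnd (m + n) =
      (α_ _ _ _).inv ≫ P.contractSnd n ▷ _ ≫ P.ins (n + 1) m := by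
  rw [contractSnd, ← whiskerLeft_comp_assoc]
  erw [← P.swap_zero_ins]
  rw [contractSnd, comp_whiskerRight, Category.assoc, P.contract_ins_succ]
  simp only [whiskerLeft_comp, Category.assoc]
  monoidal

lemma contractSnd_ins_one (m : ℕ) :
    P.obj (Fin 0) ◁ P.ins 1 (m + 1) ≫ P.contractSnd m =
      past _ (P.contractSnd m) ≫ P.ins 1 m := by
  rw [contractSnd, ← whiskerLeft_comp_assoc]
  erw [P.contract_ins_one]
  simp [past]

lemma contract_exchange (n : ℕ) :
    P.obj (Fin 0) ◁ P.contract (n + 1) ≫ P.contract n =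
      (frontIso _ _ _).hom ≫ P.obj (Fin 0) ◁ P.contractSnd n ≫ P.contract n := by
  rw [contract_contract, frontIso_hom, contractSnd]
  simp

lemma contractSnd_exchange (n : ℕ) :
    P.obj (Fin 0) ◁ (P.obj (Fin 0) ◁ P.swap 1 ≫ P.contractSnd (n + 1)) ≫ P.contractSnd n =
      (frontIso _ _ _).hom ≫ P.obj (Fin 0) ◁ P.contractSnd (n + 1) ≫ P.contractSnd n := by
  have key : ∀ f : P.obj (Fin (n + 3)) ⟶ P.obj (Fin (n + 3)),
      P.obj (Fin 0) ◁ (P.obj (Fin 0) ◁ f ≫ P.contractSnd (n + 1)) ≫ P.contractSnd n =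
        P.obj (Fin 0) ◁ (P.obj (Fin 0) ◁ (f ≫ P.swap 0 ≫ P.swap 1)) ≫
          P.obj (Fin 0) ◁ P.contract (n + 2) ≫ P.contract (n + 1) := by
    intro f
    have h := P.contract_swap_succ (n + 1) 0
    simp only [contractSnd, whiskerLeft_comp, Category.assoc]
    rw [← whiskerLeft_comp_assoc (P.obj (Fin 0)) (P.contract (n + 1 + 1)), ← h]
    simp
  have h1 := key (𝟙 _)
  simp only [whiskerLeft_id, Category.id_comp] at h1
  rw [key, h1, P.swap_braid]
  conv_rhs => rw [contract_exchange]
  rw [reassoc_of% frontIso_natural_right, reassoc_of% frontIso_frontIso, contractSnd]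
  simp

end

variable {C : Type u} [Category.{v} C] [Preadditive C] [MonoidalCategory C] [SymmetricCategory C]
  [MonoidalPreadditive C] {P : Operad C} {D N : C} [HasBinaryBiproduct D N]

section

variable [ExactPairing D (P.obj (Fin 0))] (act : P.obj (Fin 1) ⊗ N ⟶ N)

variable (D) in
/-- The component of the cooperation on the summand `N` of `D ⊞ N` which produces a factor in `N`
in the first place, and (therefore) factors in `D` in the other places: an operation `p` in
`P(n + 1)` acts on `N` once operations without inputs are inserted in the inputs other than the
first one, and `D` is dual to the object of these operations. -/
noncomputable def kappa : (n : ℕ) → (P.obj (Fin (n + 1)) ⊗ N ⟶ N ⊗ tpow (D ⊞ N) n)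
  | 0 => act ≫ (ρ_ N).inv
  | n + 1 => pairPast (W := P.obj (Fin 0)) (X := N) (Y := tpow (D ⊞ N) n)
      (onLeft (P.contractSnd n) N ≫ kappa n)

lemma kappa_ctr (n : ℕ) : P.obj (Fin 0) ◁ kappa D act (n + 1) ≫
    past N (ctr (P.obj (Fin 0)) D N (tpow (D ⊞ N) n)) =
      onLeft (P.contractSnd n) N ≫ kappa D act n :=
  pairPast_ctr _

lemma kappa_snd (n : ℕ) :
    kappa D act (n + 1) ≫ N ◁ ((biprod.snd : D ⊞ N ⟶ N) ▷ tpow (D ⊞ N) n) = 0 :=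
  pairPast_snd _

variable (D) in
/-- The cooperations `P(n) ⊗ (D ⊞ N) ⟶ (D ⊞ N)^{⊗ n}`: the contraction of the first factor of
the result is the insertion of an operation without inputs in the first input, and the component of
the first factor in `N` is given by `kappa`. -/
noncomputable def delta : (n : ℕ) → (P.obj (Fin n) ⊗ (D ⊞ N) ⟶ tpow (D ⊞ N) n)
  | 0 => P.obj (Fin 0) ◁ biprod.fst ≫ ε_ D (P.obj (Fin 0))
  | n + 1 => pair (W := P.obj (Fin 0)) (D := D) (N := N) (Y := tpow (D ⊞ N) n)
      (onLeft (P.contract n) (D ⊞ N) ≫ delta n)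
      (P.obj (Fin (n + 1)) ◁ biprod.snd ≫ kappa D act n)

lemma delta_ctr (n : ℕ) : P.obj (Fin 0) ◁ delta D act (n + 1) ≫
    ctr (P.obj (Fin 0)) D N (tpow (D ⊞ N) n) =
      onLeft (P.contract n) (D ⊞ N) ≫ delta D act n :=
  pair_ctr _ _

lemma delta_snd (n : ℕ) :
    delta D act (n + 1) ≫ (biprod.snd : D ⊞ N ⟶ N) ▷ tpow (D ⊞ N) n =
      P.obj (Fin (n + 1)) ◁ biprod.snd ≫ kappa D act n :=
  pair_snd _ _

/-- The maps `kappa` are equivariant under permutations of the inputs other than the first one. -/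
lemma kappa_swap (n : ℕ) (i : Fin n) :
    P.swap i.succ ▷ N ≫ kappa D act (n + 1) = kappa D act (n + 1) ≫ N ◁ tpowSwap (D ⊞ N) n i := by
  induction n with
  | zero => exact i.elim0
  | succ n ih =>
    refine Fin.cases ?_ (fun j => ?_) i
    -- The transposition of the first two factors in `D ⊞ N` is seen by contracting both of them.
    · refine comp_frontIso_of_past (W := P.obj (Fin 0)) (kappa_ctr act (n + 1)) (kappa_ctr act n)
        (kappa_snd act (n + 1)) (kappa_snd act n) (P.swap 1 ▷ N) ?_
      rw [whiskerLeft_onLeft]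
      exact onLeft_frontIso (P.contractSnd_exchange n) N
    · refine comp_eq_comp_of_past (W := P.obj (Fin 0)) (kappa_ctr act (n + 1))
        (kappa_ctr act (n + 1)) (kappa_snd act (n + 1)) (kappa_snd act (n + 1))
        (P.swap j.succ.succ ▷ N) (tpowSwap (D ⊞ N) n j) ?_
      rw [Category.assoc, ← ih j, ← Category.assoc, ← Category.assoc, whiskerLeft_onLeft,
        onLeft_comp, swap_contractSnd]

/-- The maps `delta` are equivariant. -/
lemma delta_swap (n : ℕ) (i : Fin n) :
    P.swap i ▷ (D ⊞ N) ≫ delta D act (n + 1) =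
      delta D act (n + 1) ≫ tpowSwap (D ⊞ N) n i := by
  induction n with
  | zero => exact i.elim0
  | succ n ih =>
    refine Fin.cases ?_ (fun j => ?_) i
    · refine comp_frontIso_of_ctr (W := P.obj (Fin 0)) (delta_ctr act (n + 1)) (delta_ctr act n)
        (delta_snd act (n + 1)) (delta_snd act n) (kappa_ctr act n)
        (kappa_snd act n) (P.swap 0 ▷ _) ?_ ?_ ?_
      · rw [← comp_whiskerRight, swap_swap, id_whiskerRight]
      · rw [whiskerLeft_onLeft]
        refine onLeft_frontIso ?_ _
        have h := P.contract_exchange n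
        rw [h, reassoc_of% frontIso_frontIso, contractSnd]
      · rw [← Category.assoc, whiskerLeft_onLeft, onLeft_exchange_right, contractSnd]
    · refine comp_eq_comp_of_ctr (W := P.obj (Fin 0)) (delta_ctr act (n + 1))
        (delta_ctr act (n + 1)) (delta_snd act (n + 1)) (delta_snd act (n + 1))
        (P.swap j.succ ▷ _) (tpowSwap (D ⊞ N) n j) ?_ ?_
      · rw [Category.assoc, ← ih j, ← Category.assoc, ← Category.assoc, whiskerLeft_onLeft,
          onLeft_comp, contract_swap_succ]
      · rw [Category.assoc, ← kappa_swap, whisker_exchange_assoc]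

variable (D) in
/-- `kappa` applied to the first factor in `N ⊗ tpow (D ⊞ N) m`. -/
noncomputable def kappaTail (n m : ℕ) :
    P.obj (Fin (n + 1)) ⊗ (N ⊗ tpow (D ⊞ N) m) ⟶ N ⊗ tpow (D ⊞ N) (m + n) :=
  onLeft (kappa D act n) _ ≫ (α_ _ _ _).hom ≫ N ◁ tpowConcat _ n m

lemma kappaTail_zero (m : ℕ) :
    kappaTail D act 0 m = onLeft act (tpow (D ⊞ N) m) := by
  have : kappaTail D act 0 m = onLeft (act ≫ (ρ_ N).inv) _ ≫ (α_ N (𝟙_ C) _).hom ≫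
    N ◁ (λ_ (tpow (D ⊞ N) m)).hom := rfl
  rw [this]
  simp [onLeft]

lemma kappaTail_ctr (n m : ℕ) : P.obj (Fin 0) ◁ kappaTail D act (n + 1) m ≫
    past N (ctr (P.obj (Fin 0)) D N (tpow (D ⊞ N) (m + n))) =
      onLeft (P.contractSnd n) _ ≫ kappaTail D act n m :=
  onLeft_past_ctr (kappa_ctr act n) _

lemma kappaTail_snd (n m : ℕ) : kappaTail D act (n + 1) m ≫
    N ◁ ((biprod.snd : D ⊞ N ⟶ N) ▷ tpow (D ⊞ N) (m + n)) = 0 :=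
  onLeft_past_snd (kappa_snd act n) _

variable (D) in
/-- `delta` applied to the first factor in `(D ⊞ N) ⊗ tpow (D ⊞ N) m`. -/
noncomputable def deltaTail (n m : ℕ) :
    P.obj (Fin n) ⊗ ((D ⊞ N) ⊗ tpow (D ⊞ N) m) ⟶ tpow (D ⊞ N) (m + n) :=
  onLeft (delta D act n) _ ≫ tpowConcat _ n m

lemma deltaTail_zero (m : ℕ) :
    deltaTail D act 0 m = ctr (P.obj (Fin 0)) D N (tpow (D ⊞ N) m) := by
  have : deltaTail D act 0 m = onLeft (P.obj (Fin 0) ◁ biprod.fst ≫ ε_ D (P.obj (Fin 0))) _ ≫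
    (λ_ (tpow (D ⊞ N) m)).hom := rfl
  rw [this, ctr, onLeft, ctrDual]
  monoidal

lemma deltaTail_ctr (n m : ℕ) : P.obj (Fin 0) ◁ deltaTail D act (n + 1) m ≫
    ctr (P.obj (Fin 0)) D N (tpow (D ⊞ N) (m + n)) =
      onLeft (P.contract n) _ ≫ deltaTail D act n m :=
  onLeft_ctr (delta_ctr act n) _

lemma deltaTail_snd (n m : ℕ) : deltaTail D act (n + 1) m ≫
    (biprod.snd : D ⊞ N ⟶ N) ▷ tpow (D ⊞ N) (m + n) =
      P.obj (Fin (n + 1)) ◁ (biprod.snd ▷ _) ≫ kappaTail D act n m :=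
  onLeft_snd (delta_snd act n) _

/-- The maps `kappa` are compatible with insertions of operations of arity one. -/
lemma ins_one_kappa (hact : onLeft P.mulOne N ≫ act = P.obj (Fin 1) ◁ act ≫ act) (m : ℕ) :
    onLeft (P.ins 1 m) N ≫ kappa D act m =
      P.obj (Fin 1) ◁ kappa D act m ≫ onLeft act (tpow (D ⊞ N) m) := by
  induction m with
  | zero =>
    have h1 : onLeft P.mulOne N ≫ act ≫ (ρ_ N).inv =
        P.obj (Fin 1) ◁ (act ≫ (ρ_ N).inv) ≫ onLeft act (𝟙_ C) := by
      rw [reassoc_of% hact]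
      simp [onLeft]
    exact h1
  | succ m ih =>
    refine comp_eq_onLeft_of_past (W := P.obj (Fin 0)) act (kappa_ctr act m) (kappa_snd act m)
      (onLeft (P.ins 1 (m + 1)) N) ?_
    rw [← Category.assoc, past_onLeft (P.contractSnd_ins_one m), Category.assoc, ih, ← past_comp,
      Category.assoc]

/-- The maps `kappa` are compatible with insertions in the first input: contracting a factor which
comes from the inserted operation lowers the arity of that operation. -/
lemma ins_kappa (hact : onLeft P.mulOne N ≫ act = P.obj (Fin 1) ◁ act ≫ act) (n m : ℕ) :
    onLeft (P.ins (n + 1) m) N ≫ kappa D act (m + n) =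
      P.obj (Fin (n + 1)) ◁ kappa D act m ≫ kappaTail D act n m := by
  induction n with
  | zero =>
    rw [kappaTail_zero]
    exact ins_one_kappa act hact m
  | succ n ih =>
    refine comp_eq_of_past (W := P.obj (Fin 0)) (kappa_ctr act (m + n)) (kappaTail_ctr act n m)
      (kappa_snd act (m + n)) (kappaTail_snd act n m) (onLeft (P.ins (n + 2) m) N)
      (P.obj (Fin (n + 2)) ◁ kappa D act m) ?_
    have h := P.contractSnd_ins n m
    rw [← Category.assoc] at h
    rw [← Category.assoc, onLeft_onLeft h, Category.assoc, ih, ← Category.assoc, ← Category.assoc,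
      onLeft_exchange_right]

/-- The maps `delta` are compatible with insertions in the first input. For an inserted operation
without inputs this is the defining property `delta_ctr`, and contracting the first factor lowers
the arity of the inserted operation. -/
lemma ins_delta (hact : onLeft P.mulOne N ≫ act = P.obj (Fin 1) ◁ act ≫ act) (n m : ℕ) :
    onLeft (P.ins n m) (D ⊞ N) ≫ delta D act (m + n) =
      P.obj (Fin n) ◁ delta D act (m + 1) ≫ deltaTail D act n m := by
  induction n with
  | zero =>
    rw [deltaTail_zero]
    exact (delta_ctr act m).symm
  | succ n ih =>
    refine comp_eq_of_ctr (W := P.obj (Fin 0)) (delta_ctr act (m + n)) (deltaTail_ctr act n m)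
      (delta_snd act (m + n)) (deltaTail_snd act n m) (onLeft (P.ins (n + 1) m) (D ⊞ N))
      (P.obj (Fin (n + 1)) ◁ delta D act (m + 1)) ?_ ?_
    · have h : P.obj (Fin 0) ◁ P.ins (n + 1) m ≫ P.contract (m + n) =
          onLeft (P.contract n) _ ≫ P.ins n m := by
        rw [onLeft, Category.assoc, contract_ins_succ, Iso.inv_hom_id_assoc]
      rw [← Category.assoc, onLeft_onLeft h, Category.assoc, ih]
      exact (onLeft_exchange_right_assoc _ _ _).symm
    · refine ((onLeft_exchange_right_assoc _ _ _).symm.trans ?_).trans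
        ((whiskerLeft_comp_assoc _ _ _ _).symm.trans
          ((congrArg (fun f => P.obj (Fin (n + 1)) ◁ f ≫ kappaTail D act n m)
            (delta_snd act m)).trans (whiskerLeft_comp_assoc _ _ _ _))).symm
      rw [ins_kappa act hact]

/-- The `P`-coalgebra `D ⊞ N`, for a module `N` over the monoid `P(1)` and a dual `D` of `P(0)`. -/
noncomputable def squareZero (hact : onLeft P.mulOne N ≫ act = P.obj (Fin 1) ◁ act ≫ act)
    (hone : P.one ▷ N ≫ act = (λ_ N).hom) : Coalg P where
  V := D ⊞ N
  δ := delta D act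
  equivariant := delta_swap act
  counit := by
    refine (comp_eq_of_ctr (W := P.obj (Fin 0)) (delta_ctr act 0) rfl (delta_snd act 0) rfl
      (d' := 𝟙 ((D ⊞ N) ⊗ 𝟙_ C)) (P.one ▷ (D ⊞ N)) ((λ_ _).hom ≫ (ρ_ _).inv) ?_ ?_).trans
      (Category.comp_id _)
    · have h : P.obj (Fin 0) ◁ (P.one ▷ (D ⊞ N)) ≫ onLeft (P.contract 0) (D ⊞ N) ≫
          P.obj (Fin 0) ◁ biprod.fst ≫ ε_ D (P.obj (Fin 0)) =
          P.obj (Fin 0) ◁ ((λ_ (D ⊞ N)).hom ≫ (ρ_ (D ⊞ N)).inv) ≫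
            P.obj (Fin 0) ◁ 𝟙 ((D ⊞ N) ⊗ 𝟙_ C) ≫ ctr (P.obj (Fin 0)) D N (𝟙_ C) := by
        rw [← Category.assoc, whiskerLeft_onLeft, contract_one, ctr, onLeft, ctrDual]
        monoidal
      exact h
    · have h : P.one ▷ (D ⊞ N) ≫ P.obj (Fin 1) ◁ biprod.snd ≫ act ≫ (ρ_ N).inv =
          ((λ_ (D ⊞ N)).hom ≫ (ρ_ (D ⊞ N)).inv) ≫ 𝟙 ((D ⊞ N) ⊗ 𝟙_ C) ≫ biprod.snd ▷ 𝟙_ C := by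
        rw [← whisker_exchange_assoc, reassoc_of% hone]
        simp
      exact h
  coassoc m n := by
    have h : (P.comp (Fin m) (Fin n) ≫ P.map (concatEquiv n m)) ▷ (D ⊞ N) =
        (β_ _ _).hom ▷ _ ≫ (α_ _ _ _).hom ≫
          P.obj (Fin n) ◁ (P.map (finSuccEquiv m).symm ▷ (D ⊞ N)) ≫
          onLeft (P.ins n m) (D ⊞ N) := by
      rw [onLeft, associator_inv_naturality_middle_assoc, Iso.hom_inv_id_assoc,
        ← comp_whiskerRight, ← comp_whiskerRight, ins, insert, Category.assoc,
        ← whiskerLeft_comp_assoc, map_comp_map, Equiv.symm_trans_self, P.map_refl,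
        whiskerLeft_id, Category.id_comp, SymmetricCategory.symmetry_assoc]
    rw [h]
    simp only [Category.assoc]
    rw [ins_delta act hact]
    simp only [whiskerLeft_comp, Category.assoc]
    rw [deltaTail, onLeft, Category.assoc]
    rfl

end

end SquareZero

/-! ### Objects which depend on a condition -/

section Restrict

variable {C : Type u} [Category.{v} C] [HasZeroMorphisms C] [HasZeroObject C]

open scoped ZeroObject

open Classical in
/-- The object `E` if `p` holds, and zero otherwise. -/
noncomputable def restrict (p : Prop) (E : C) : C := if p then E else 0

/-- The map `E ⟶ restrict p E`, which is the identity if `p` holds and zero otherwise. -/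
noncomputable def restrictIn (p : Prop) (E : C) : E ⟶ restrict p E :=
  open Classical in
  if h : p then eqToHom (if_pos h).symm else 0

/-- The map `restrict p E ⟶ E`, which is the identity if `p` holds and zero otherwise. -/
noncomputable def restrictOut (p : Prop) (E : C) : restrict p E ⟶ E :=
  open Classical in
  if h : p then eqToHom (if_pos h) else 0

lemma restrictIn_out {p : Prop} (h : p) (E : C) : restrictIn p E ≫ restrictOut p E = 𝟙 E := by
  rw [restrictIn, restrictOut, dif_pos h, dif_pos h]
  exact eqToHom_trans _ _

lemma restrictIn_out_assoc {p : Prop} (h : p) {E T : C} (f : E ⟶ T) :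
    restrictIn p E ≫ restrictOut p E ≫ f = f := by
  rw [← Category.assoc, restrictIn_out h, Category.id_comp]

lemma isZero_restrict {p : Prop} (h : ¬ p) (E : C) : IsZero (restrict p E) := by
  rw [restrict, if_neg h]
  exact isZero_zero C

lemma restrictOut_in (p : Prop) (E : C) : restrictOut p E ≫ restrictIn p E = 𝟙 _ := by
  by_cases h : p
  · rw [restrictIn, restrictOut, dif_pos h, dif_pos h]
    exact eqToHom_trans _ _
  · exact (isZero_restrict h E).eq_of_src _ _

lemma restrictIn_eq_zero {p : Prop} (h : ¬ p) (E : C) : restrictIn p E = 0 :=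
  (isZero_restrict h E).eq_of_tgt _ _

end Restrict

/-! ### Chain maps out of tensor products -/

section Tensor

variable {A : Type u} [Category.{v} A] [Preadditive A] [MonoidalCategory A] [SymmetricCategory A]
  [MonoidalClosed A] [HasColimits A]

open HomologicalComplex

lemma tensor_hom_ext {K L : ChainComplex A ℤ} {n : ℤ} {T : A} {f g : (K ⊗ L).X n ⟶ T}
    (h : ∀ (i j : ℤ) (hij : i + j = n), ιTensorObj K L i j n hij ≫ f =
      ιTensorObj K L i j n hij ≫ g) : f = g :=
  mapBifunctor.hom_ext (K₁ := K) (K₂ := L) (F := curriedTensor A) (c := ComplexShape.down ℤ) h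

/-- A chain map out of a tensor product, given by its components. The condition is the Leibniz rule
for the differential `d (x ⊗ y) = d x ⊗ y + (-1) ^ |x| x ⊗ d y`. -/
noncomputable def tensorDesc {K L M : ChainComplex A ℤ}
    (φ : ∀ i j n : ℤ, i + j = n → (K.X i ⊗ L.X j ⟶ M.X n))
    (hφ : ∀ (i j n m : ℤ) (h : i + j = n) (hm : m + 1 = n), φ i j n h ≫ M.d n m =
      K.d i (i - 1) ▷ L.X j ≫ φ (i - 1) j m (by lia) +
        i.negOnePow • (K.X i ◁ L.d j (j - 1) ≫ φ i (j - 1) m (by lia))) : K ⊗ L ⟶ M where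
  f n := mapBifunctorDesc (K₁ := K) (K₂ := L) (F := curriedTensor A)
    (c := ComplexShape.down ℤ) fun i j h => φ i j n h
  comm' := by
    rintro n m hnm
    have hnm' : m + 1 = n := hnm
    apply mapBifunctor.hom_ext
    intro i j h
    have h' : i + j = n := h
    rw [ι_mapBifunctorDesc_assoc]
    change _ = _ ≫ (mapBifunctor K L _ _).d n m ≫ _
    have hi : (ComplexShape.down ℤ).Rel i (i-1) := by change _ + 1 = _; lia
    have hj : (ComplexShape.down ℤ).Rel j (j-1) := by change _ + 1 = _; lia
    have e1 : ComplexShape.π (ComplexShape.down ℤ) (ComplexShape.down ℤ) (ComplexShape.down ℤ)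
      (i-1, j) = m := by change i - 1 + j = m; lia
    have e2 : ComplexShape.π (ComplexShape.down ℤ) (ComplexShape.down ℤ) (ComplexShape.down ℤ)
      (i, j-1) = m := by change i + (j-1) = m; lia
    rw [mapBifunctor.d_eq, Preadditive.add_comp, Preadditive.comp_add,
      mapBifunctor.ι_D₁_assoc, mapBifunctor.ι_D₂_assoc,
      mapBifunctor.d₁_eq _ _ _ _ hi _ _ e1, mapBifunctor.d₂_eq _ _ _ _ _ hj _ e2,
      Linear.units_smul_comp, Linear.units_smul_comp, Category.assoc, Category.assoc,
      ι_mapBifunctorDesc, ι_mapBifunctorDesc]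
    refine (hφ i j n m h' hnm').trans ?_
    congr 1
    exact (one_smul _ _).symm

lemma ι_tensorDesc {K L M : ChainComplex A ℤ}
    (φ : ∀ i j n : ℤ, i + j = n → (K.X i ⊗ L.X j ⟶ M.X n)) (hφ) (i j n : ℤ) (h : i + j = n) :
    ιTensorObj K L i j n h ≫ (tensorDesc φ hφ).f n = φ i j n h :=
  ι_mapBifunctorDesc (K₁ := K) (K₂ := L) (F := curriedTensor A) (c := ComplexShape.down ℤ)
    (fun i j h => φ i j n h) i j h

end Tensor

/-! ### Contractible complexes -/

section Disk

variable (A : Type u) [Category.{v} A] [Preadditive A] [MonoidalCategory A] [HasZeroObject A]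

/-- The contractible complex with the tensor unit in the degrees `a` and `a - 1`. -/
noncomputable def disk (a : ℤ) : ChainComplex A ℤ where
  X i := restrict (i = a ∨ i + 1 = a) (𝟙_ A)
  d i j := if j + 1 = i then restrictOut _ _ ≫ restrictIn _ _ else 0
  shape i j h := if_neg h
  d_comp_d' i j k hij hjk := by
    have hij' : j + 1 = i := hij
    have hjk' : k + 1 = j := hjk
    rw [if_pos hij', if_pos hjk']
    by_cases h : i = a ∨ i + 1 = a
    · rw [restrictIn_eq_zero (p := k = a ∨ k + 1 = a) (by lia), comp_zero, comp_zero]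
    · exact (isZero_restrict h _).eq_of_src _ _

variable {A}

/-- The map from the tensor unit to the component of degree `i` of a disk. -/
noncomputable def diskIn (a i : ℤ) : 𝟙_ A ⟶ (disk A a).X i := restrictIn _ _

/-- The map from the component of degree `i` of a disk to the tensor unit. -/
noncomputable def diskOut (a i : ℤ) : (disk A a).X i ⟶ 𝟙_ A := restrictOut _ _

lemma diskIn_out {a i : ℤ} (h : i = a ∨ i + 1 = a) : diskIn a i ≫ diskOut a i = 𝟙 (𝟙_ A) :=
  restrictIn_out h _

lemma diskIn_out_assoc {a i : ℤ} (h : i = a ∨ i + 1 = a) {T : A} (f : 𝟙_ A ⟶ T) :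
    diskIn a i ≫ diskOut a i ≫ f = f :=
  restrictIn_out_assoc h f

lemma diskOut_in (a i : ℤ) : diskOut a i ≫ diskIn a i = 𝟙 ((disk A a).X i) :=
  restrictOut_in _ _

lemma isZero_disk {a i : ℤ} (h : ¬ (i = a ∨ i + 1 = a)) : IsZero ((disk A a).X i) :=
  isZero_restrict h _

lemma disk_d {a i j : ℤ} (h : j + 1 = i) : (disk A a).d i j = diskOut a i ≫ diskIn a j :=
  if_pos h

lemma diskIn_d {a i j : ℤ} (h : j + 1 = i) (hi : i = a) :
    diskIn a i ≫ (disk A a).d i j = diskIn a j := by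
  rw [disk_d h, diskIn_out_assoc (by lia)]

lemma diskIn_d_eq_zero {a i : ℤ} (j : ℤ) (h : i ≠ a) : diskIn a i ≫ (disk A a).d i j = 0 := by
  by_cases hij : j + 1 = i
  · by_cases hj : j = a ∨ j + 1 = a
    · exact (diskIn a i ≫= (isZero_disk (by lia)).eq_of_src _ 0).trans comp_zero
    · exact (isZero_disk hj).eq_of_tgt _ _
  · rw [(disk A a).shape i j hij, comp_zero]

lemma disk_exactAt (a i : ℤ) : (disk A a).ExactAt i := by
  have hiso : ∀ i, i + 1 = a → IsIso ((disk A a).d a i) := by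
    intro i h
    rw [disk_d h]
    refine ⟨diskOut a i ≫ diskIn a a, ?_, ?_⟩
    · rw [Category.assoc, diskIn_out_assoc (by lia), diskOut_in]
    · rw [Category.assoc, diskIn_out_assoc (by lia), diskOut_in]
  rw [(disk A a).exactAt_iff' (i + 1) i (i - 1) (by simp) (by simp)]
  by_cases h : i = a
  · subst h
    exact (ShortComplex.Splitting.ofIsZeroOfIsIso _ (isZero_disk (by lia))
      (hiso _ (by lia))).exact
  · by_cases h' : i + 1 = a
    · subst h'
      exact (ShortComplex.Splitting.ofIsIsoOfIsZero _ (hiso _ rfl)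
        (isZero_disk (by lia))).exact
    · exact ShortComplex.exact_of_isZero_X₂ _ (isZero_disk (by lia))

/-- The chain map to `disk a` with prescribed component in degree `b = a - 1`; it is the composition
of the differential with that component in degree `a`. In the other degrees the target is zero, so
that it does not matter which map is written. -/
noncomputable def toDisk {K : ChainComplex A ℤ} {a b : ℤ} (hb : b + 1 = a) (r : K.X b ⟶ 𝟙_ A) :
    K ⟶ disk A a where
  f i := if h : i = b then eqToHom (by rw [h]) ≫ r ≫ diskIn a i else
    K.d i b ≫ r ≫ diskIn a i
  comm' i j hij := by
    have hij' : j + 1 = i := hij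
    by_cases h : i = b
    · subst h
      rw [dif_pos rfl]
      exact (isZero_disk (by lia)).eq_of_tgt _ _
    · rw [dif_neg h, Category.assoc, Category.assoc]
      by_cases hj : j = b
      · subst hj
        rw [dif_pos rfl, diskIn_d hij' (by lia)]
        simp
      · rw [dif_neg hj, diskIn_d_eq_zero _ (by lia)]
        simp

lemma toDisk_f {K : ChainComplex A ℤ} {a b : ℤ} (hb : b + 1 = a) (r : K.X b ⟶ 𝟙_ A) :
    (toDisk hb r).f b = r ≫ diskIn a b :=
  (dif_pos rfl).trans (Category.id_comp _)

end Disk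

section Action

variable {A : Type u} [Category.{v} A] [Preadditive A] [MonoidalCategory A] [SymmetricCategory A]
  [MonoidalClosed A] [HasColimits A]

open HomologicalComplex

/-- Maps out of a tensor product of components of disks may be compared on the tensor unit. -/
lemma disk_tensor_hom_ext {a b i j : ℤ} {T : A} {f g : (disk A a).X i ⊗ (disk A b).X j ⟶ T}
    (h : (i = a ∨ i + 1 = a) → (j = b ∨ j + 1 = b) →
      (diskIn a i ⊗ₘ diskIn b j) ≫ f = (diskIn a i ⊗ₘ diskIn b j) ≫ g) : f = g := by
  by_cases hi : i = a ∨ i + 1 = a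
  · by_cases hj : j = b ∨ j + 1 = b
    · have e : (diskOut (A := A) a i ⊗ₘ diskOut (A := A) b j) ≫
          (diskIn a i ⊗ₘ diskIn b j) = 𝟙 _ := by
        rw [MonoidalCategory.tensorHom_comp_tensorHom, diskOut_in, diskOut_in,
          id_tensorHom_id]
      have := (diskOut a i ⊗ₘ diskOut b j) ≫= h hi hj
      rw [reassoc_of% e, reassoc_of% e] at this
      exact this
    · exact (isZero_tensor_right (isZero_disk hj) _).eq_of_src _ _
  · exact (isZero_tensor_left (isZero_disk hi) _).eq_of_src _ _

/-- The multiplication on the components of disks: the multiplication of the tensor unit, if both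
degrees occur in the factors and `n` occurs in the target, and zero otherwise. -/
noncomputable def diskMulX (a b i j n : ℤ) :
    (disk A a).X i ⊗ (disk A b).X j ⟶ (disk A b).X n :=
  (diskOut a i ⊗ₘ diskOut b j) ≫ (λ_ _).hom ≫ diskIn b n

lemma diskIn_diskMulX {a b i j : ℤ} (n : ℤ) (hi : i = a ∨ i + 1 = a) (hj : j = b ∨ j + 1 = b) :
    (diskIn (A := A) a i ⊗ₘ diskIn (A := A) b j) ≫ diskMulX a b i j n =
      (λ_ _).hom ≫ diskIn b n := by
  rw [diskMulX, MonoidalCategory.tensorHom_comp_tensorHom_assoc, diskIn_out hi,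
    diskIn_out hj, id_tensorHom_id, Category.id_comp]

/-- The multiplication `disk 1 ⊗ disk a ⟶ disk a`. -/
noncomputable def diskMul (a : ℤ) : disk A 1 ⊗ disk A a ⟶ disk A a :=
  tensorDesc (fun i j n _ => diskMulX 1 a i j n) (by
    intro i j n m h hm
    apply disk_tensor_hom_ext
    intro hi hj
    have hr : (diskIn 1 i ⊗ₘ diskIn a j) ≫ (disk A 1).d i (i - 1) ▷ (disk A a).X j =
      ((diskIn 1 i ≫ (disk A 1).d i (i - 1)) ⊗ₘ diskIn a j) := by
      simp [MonoidalCategory.tensorHom_def', ← comp_whiskerRight]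
    have hl : (diskIn 1 i ⊗ₘ diskIn a j) ≫ (disk A 1).X i ◁ (disk A a).d j (j - 1) =
      (diskIn 1 i ⊗ₘ (diskIn a j ≫ (disk A a).d j (j - 1))) := by
      simp [MonoidalCategory.tensorHom_def]
    rw [Preadditive.comp_add, Linear.comp_units_smul, reassoc_of% hr, reassoc_of% hl,
      reassoc_of% diskIn_diskMulX n hi hj]
    -- In the case `i = 1`, `j = a`, the two terms of the Leibniz rule cancel, since `(-1) ^ i = -1`
    -- and both differentials are the identity. In the other cases, at most one term is nonzero.
    rcases hi with hi | hi <;> rcases hj with hj | hj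
    · rw [diskIn_d (by lia) hi, diskIn_d (by lia) hj, diskIn_d_eq_zero _ (by lia),
        diskIn_diskMulX _ (by lia) (by lia), diskIn_diskMulX _ (by lia) (by lia), hi]
      simp
    · rw [diskIn_d (by lia) hi, diskIn_d_eq_zero (a := a) (j - 1) (by lia),
        diskIn_diskMulX _ (by lia) (by lia), diskIn_d (by lia) (by lia)]
      simp
    · rw [diskIn_d_eq_zero (a := 1) _ (by lia), diskIn_d (by lia) hj,
        diskIn_diskMulX _ (by lia) (by lia), diskIn_d (by lia) (by lia),
        show i = 0 by lia]
      simp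
    · rw [diskIn_d_eq_zero (a := 1) _ (by lia), diskIn_d_eq_zero (a := a) (j - 1) (by lia),
        diskIn_d_eq_zero (a := a) _ (by lia)]
      simp)

end Action

/-! ### The algebra `disk 1` -/

section Disks

section

variable {A : Type u} [Category.{v} A] [Preadditive A]

open HomologicalComplex

lemma epi_of_f {K L : ChainComplex A ℤ} (f : K ⟶ L) (h : ∀ i, Epi (f.f i)) : Epi f := by
  refine ⟨fun g g' hg => ?_⟩
  ext i
  rw [← cancel_epi (f.f i), ← comp_f, hg, comp_f]

end

variable {A : Type u} [Category.{v} A] [Preadditive A] [MonoidalCategory A] [SymmetricCategory A]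
  [MonoidalClosed A] [HasColimits A]

open HomologicalComplex

lemma ι_diskMul (a i j n : ℤ) (h : i + j = n) :
    ιTensorObj (disk A 1) (disk A a) i j n h ≫ (diskMul a).f n = diskMulX 1 a i j n :=
  ι_tensorDesc _ _ i j n h

variable (A) in
/-- The component in degree zero of the unit of the tensor product of complexes. -/
noncomputable def unitX : (𝟙_ (ChainComplex A ℤ)).X 0 ≅ 𝟙_ A :=
  singleObjXSelf (ComplexShape.down ℤ) 0 (𝟙_ A)

lemma isZero_unit_X {i : ℤ} (h : i ≠ 0) : IsZero ((𝟙_ (ChainComplex A ℤ)).X i) :=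
  isZero_single_obj_X (ComplexShape.down ℤ) 0 (𝟙_ A) i h

lemma leftUnitor_inv_f (K : ChainComplex A ℤ) (i : ℤ) : (λ_ K).inv.f i =
    (λ_ (K.X i)).inv ≫ (unitX A).inv ▷ K.X i ≫
      ιTensorObj (𝟙_ (ChainComplex A ℤ)) K 0 i i (zero_add i) :=
  leftUnitor'_inv K i

lemma rightUnitor_inv_f (K : ChainComplex A ℤ) (i : ℤ) : (ρ_ K).inv.f i =
    (ρ_ (K.X i)).inv ≫ K.X i ◁ (unitX A).inv ≫
      ιTensorObj K (𝟙_ (ChainComplex A ℤ)) i 0 i (add_zero i) :=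
  rightUnitor'_inv K i

variable (A) in
/-- The unit of the algebra `disk 1`. -/
noncomputable def diskOne : 𝟙_ (ChainComplex A ℤ) ⟶ disk A 1 :=
  mkHomFromSingle (c := ComplexShape.down ℤ) (j := 0) (diskIn 1 0)
    fun _ _ => diskIn_d_eq_zero _ (by simp)

lemma diskOne_f : (diskOne A).f 0 = (unitX A).hom ≫ diskIn 1 0 :=
  mkHomFromSingle_f _ _

lemma tensor₃_hom_ext {K L M : ChainComplex A ℤ} {n : ℤ} {T : A}
    {f g : ((K ⊗ L) ⊗ M).X n ⟶ T}
    (h : ∀ (i j k : ℤ) (h : i + j + k = n),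
      ιTensorObj K L i j (i + j) rfl ▷ M.X k ≫ ιTensorObj (K ⊗ L) M (i + j) k n h ≫ f =
      ιTensorObj K L i j (i + j) rfl ▷ M.X k ≫ ιTensorObj (K ⊗ L) M (i + j) k n h ≫ g) :
    f = g := by
  apply GradedObject.Monoidal.tensorObj₃'_ext (X₁ := K.X) (X₂ := L.X) (X₃ := M.X)
  intro i j k hn
  have := h i j k hn
  rw [GradedObject.Monoidal.ιTensorObj₃'_eq K.X L.X M.X i j k n hn _ rfl]
  exact (Category.assoc _ _ _).trans (this.trans (Category.assoc _ _ _).symm)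

lemma ι_associator (K L M : ChainComplex A ℤ) (i j k n : ℤ) (h : i + j + k = n)
    (h' : i + (j + k) = n) :
    ιTensorObj K L i j (i + j) rfl ▷ M.X k ≫ ιTensorObj (K ⊗ L) M (i + j) k n h ≫
      (α_ K L M).hom.f n = (α_ _ _ _).hom ≫ K.X i ◁ ιTensorObj L M j k (j + k) rfl ≫
        ιTensorObj K (L ⊗ M) i (j + k) n h' := by
  have := GradedObject.Monoidal.ιTensorObj₃'_associator_hom (X₁ := K.X) (X₂ := L.X)
    (X₃ := M.X) i j k n h
  rw [GradedObject.Monoidal.ιTensorObj₃'_eq K.X L.X M.X i j k n h _ rfl,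
    GradedObject.Monoidal.ιTensorObj₃_eq K.X L.X M.X i j k n h _ rfl, Category.assoc] at this
  exact this

lemma diskMulX_assoc (i j k n : ℤ) (h : i + j + k = n) :
    diskMulX 1 1 i j (i + j) ▷ (disk A 1).X k ≫ diskMulX 1 1 (i + j) k n =
      (α_ _ _ _).hom ≫ (disk A 1).X i ◁ diskMulX 1 1 j k (j + k) ≫ diskMulX 1 1 i (j + k) n := by
  by_cases hi : i = 1 ∨ i + 1 = 1
  swap
  · exact (isZero_tensor_left (isZero_tensor_left (isZero_disk hi) _) _).eq_of_src _ _
  by_cases hj : j = 1 ∨ j + 1 = 1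
  swap
  · exact (isZero_tensor_left (isZero_tensor_right (isZero_disk hj) _) _).eq_of_src _ _
  by_cases hk : k = 1 ∨ k + 1 = 1
  swap
  · exact (isZero_tensor_right (isZero_disk hk) _).eq_of_src _ _
  by_cases hn : n = 1 ∨ n + 1 = 1
  swap
  · exact (isZero_disk hn).eq_of_tgt _ _
  have h1 : diskMulX (A := A) 1 1 i j (i + j) ▷ (disk A 1).X k ≫ diskMulX 1 1 (i + j) k n =
      ((((diskOut 1 i ⊗ₘ diskOut 1 j) ≫ (λ_ (𝟙_ A)).hom) ⊗ₘ diskOut 1 k) ≫ (λ_ (𝟙_ A)).hom) ≫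
        diskIn 1 n := by
    rw [diskMulX, diskMulX, ← tensorHom_id, ← Category.assoc,
      MonoidalCategory.tensorHom_comp_tensorHom, Category.id_comp, Category.assoc, Category.assoc,
      diskIn_out (by lia), Category.comp_id, Category.assoc]
  have h2 : (disk A 1).X i ◁ diskMulX 1 1 j k (j + k) ≫ diskMulX 1 1 i (j + k) n =
      (diskOut 1 i ⊗ₘ ((diskOut 1 j ⊗ₘ diskOut 1 k) ≫ (λ_ (𝟙_ A)).hom)) ≫ (λ_ (𝟙_ A)).hom ≫
        diskIn 1 n := by
    rw [diskMulX, diskMulX, ← id_tensorHom, ← Category.assoc,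
      MonoidalCategory.tensorHom_comp_tensorHom, Category.id_comp, Category.assoc, Category.assoc,
      diskIn_out (by lia), Category.comp_id]
  rw [h1, h2, unit_assoc_aux, Category.assoc, Category.assoc]

/-- The algebra `disk 1`. -/
noncomputable instance : MonObj (disk A 1) where
  one := diskOne A
  mul := diskMul 1
  one_mul := by
    rw [← cancel_epi (λ_ (disk A 1)).inv, Iso.inv_hom_id]
    ext i
    rw [comp_f, comp_f, leftUnitor_inv_f, Category.assoc, Category.assoc]
    have h1 := Koszul.ι_whiskerRight (diskOne A) (disk A 1) 0 i i (zero_add i)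
    rw [reassoc_of% h1, ι_diskMul, diskOne_f, ← comp_whiskerRight_assoc, Iso.inv_hom_id_assoc,
      diskMulX, ← tensorHom_id, ← Category.assoc (diskIn 1 0 ⊗ₘ _),
      MonoidalCategory.tensorHom_comp_tensorHom, diskIn_out (by simp), Category.id_comp,
      id_tensorHom, leftUnitor_naturality_assoc, diskOut_in, Iso.inv_hom_id_assoc]
    rfl
  mul_one := by
    rw [← cancel_epi (ρ_ (disk A 1)).inv, Iso.inv_hom_id]
    ext i
    rw [comp_f, comp_f, rightUnitor_inv_f, Category.assoc, Category.assoc]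
    have h1 := Koszul.ι_whiskerLeft (disk A 1) (diskOne A) i 0 i (add_zero i)
    rw [reassoc_of% h1, ι_diskMul, diskOne_f, ← whiskerLeft_comp_assoc, Iso.inv_hom_id_assoc,
      diskMulX, ← id_tensorHom, ← Category.assoc (_ ⊗ₘ diskIn 1 0),
      MonoidalCategory.tensorHom_comp_tensorHom, diskIn_out (by simp), Category.id_comp,
      tensorHom_id, unitors_equal, rightUnitor_naturality_assoc, diskOut_in,
      Iso.inv_hom_id_assoc]
    rfl
  mul_assoc := by
    ext n
    apply tensor₃_hom_ext
    intro i j k h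
    have h' : i + (j + k) = n := by lia
    have e1 := Koszul.ι_whiskerRight (diskMul (A := A) 1) (disk A 1) (i + j) k n h
    have e2 := Koszul.ι_whiskerLeft (disk A 1) (diskMul (A := A) 1) i (j + k) n h'
    rw [comp_f, comp_f, comp_f, reassoc_of% e1, ι_diskMul, ← comp_whiskerRight_assoc, ι_diskMul,
      reassoc_of% ι_associator _ _ _ i j k n h h', reassoc_of% e2, ι_diskMul,
      ← whiskerLeft_comp_assoc, ι_diskMul, diskMulX_assoc _ _ _ _ h]

variable (A) in
/-- The map from `disk 0` to the unit, which is the identity in degree zero. -/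
noncomputable def diskToUnit : disk A 0 ⟶ 𝟙_ (ChainComplex A ℤ) :=
  mkHomToSingle (c := ComplexShape.down ℤ) (j := 0) (diskOut 0 0) fun _ _ =>
    (isZero_disk (by simp_all; lia)).eq_of_src _ _

lemma diskToUnit_f : (diskToUnit A).f 0 = diskOut 0 0 ≫ (unitX A).inv :=
  mkHomToSingle_f _ _

lemma epi_whiskerRight {K L : ChainComplex A ℤ} (f : K ⟶ L) (hf : ∀ i, IsSplitEpi (f.f i))
    (X : ChainComplex A ℤ) : Epi (f ▷ X) := by
  apply epi_of_f
  intro n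
  refine ⟨fun g g' hg => ?_⟩
  apply tensor_hom_ext
  intro i j h
  have e : IsSplitEpi (f.f i ▷ X.X j) := inferInstanceAs (IsSplitEpi ((tensorRight _).map _))
  have h1 := Koszul.ι_whiskerRight f X i j n h
  rw [← cancel_epi (f.f i ▷ X.X j), ← reassoc_of% h1, hg, reassoc_of% h1]

/-- If the unit `u` of `K` is a split monomorphism in degree zero, then there is an epimorphism
from `K ⊗ Z` to `X` for some `Z`: the retraction gives a chain map from `K` to `disk 1`, which
acts on `disk 0`, and `disk 0` surjects onto the unit. -/
lemma exists_epi_tensor {K : ChainComplex A ℤ} (u : 𝟙_ (ChainComplex A ℤ) ⟶ K)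
    (hu : IsSplitMono (u.f 0)) (X : ChainComplex A ℤ) :
    ∃ (Z : ChainComplex A ℤ) (q : K ⊗ Z ⟶ X), Epi q := by
  let r : K.X 0 ⟶ 𝟙_ A := retraction (u.f 0) ≫ (unitX A).hom
  let f : K ⊗ disk A 0 ⟶ 𝟙_ (ChainComplex A ℤ) :=
    toDisk (a := 1) (zero_add 1) r ▷ _ ≫ diskMul 0 ≫ diskToUnit A
  have hf : ∀ i, IsSplitEpi (f.f i) := by
    intro i
    by_cases hi : i = 0
    · subst hi
      refine ⟨⟨⟨(unitX A).hom ≫ (λ_ _).inv ≫ (((unitX A).inv ≫ u.f 0) ⊗ₘ diskIn 0 0) ≫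
        ιTensorObj K (disk A 0) 0 0 0 (zero_add 0), ?_⟩⟩⟩
      have h1 := Koszul.ι_whiskerRight (toDisk (a := 1) (zero_add 1) r) (disk A 0) 0 0 0
        (zero_add 0)
      dsimp only [f]
      simp only [comp_f, Category.assoc]
      rw [reassoc_of% h1, reassoc_of% ι_diskMul, toDisk_f, diskToUnit_f, diskMulX]
      have h2 : (((unitX A).inv ≫ u.f 0) ⊗ₘ diskIn 0 0) ≫ (r ≫ diskIn 1 0) ▷ (disk A 0).X 0 ≫
          (diskOut 1 0 ⊗ₘ diskOut 0 0) = 𝟙 (𝟙_ A ⊗ 𝟙_ A) := by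
        rw [← tensorHom_id, MonoidalCategory.tensorHom_comp_tensorHom,
          MonoidalCategory.tensorHom_comp_tensorHom]
        simp only [Category.assoc, Category.id_comp, r]
        rw [diskIn_out (by simp), diskIn_out (by simp), Category.comp_id, IsSplitMono.id_assoc,
          Iso.inv_hom_id, id_tensorHom_id]
      simp only [Category.assoc]
      rw [reassoc_of% h2, Iso.inv_hom_id_assoc, diskIn_out_assoc (by simp), Iso.hom_inv_id]
    · have h0 := isZero_unit_X (A := A) hi
      exact ⟨⟨⟨0, h0.eq_of_src _ _⟩⟩⟩
  have := epi_whiskerRight f hf X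
  exact ⟨disk A 0 ⊗ X, (α_ _ _ _).inv ≫ f ▷ X ≫ (λ_ X).hom, inferInstance⟩

end Disks

/-! ### Operads concentrated in arity one -/

section ArityOne

open scoped MonObj

lemma mul_out_assoc {C : Type u} [Category.{v} C] [MonoidalCategory C] (E : C) [MonObj E] {X Y Z : C} (a : X ⟶ E) (b : Y ⟶ E) (c : Z ⟶ E) :
    (((a ⊗ₘ b) ≫ μ[E]) ⊗ₘ c) ≫ μ[E] =
      (α_ X Y Z).hom ≫ (a ⊗ₘ ((b ⊗ₘ c) ≫ μ[E])) ≫ μ[E] := by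
  have h1 : ((a ⊗ₘ b) ≫ μ[E]) ⊗ₘ c = ((a ⊗ₘ b) ⊗ₘ c) ≫ μ[E] ▷ E := by
    rw [← MonoidalCategory.tensorHom_id, MonoidalCategory.tensorHom_comp_tensorHom,
      Category.comp_id]
  have h2 : a ⊗ₘ ((b ⊗ₘ c) ≫ μ[E]) = (a ⊗ₘ (b ⊗ₘ c)) ≫ E ◁ μ[E] := by
    rw [← MonoidalCategory.id_tensorHom, MonoidalCategory.tensorHom_comp_tensorHom,
      Category.comp_id]
  rw [h1, h2, Category.assoc, Category.assoc, MonObj.mul_assoc, associator_naturality_assoc]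

variable {C : Type u} [Category.{v} C] [Preadditive C] [HasZeroObject C] [MonoidalCategory C]
  [SymmetricCategory C] [MonoidalPreadditive C]

/-- A monoid `E`, as an operad which is zero in the arities other than one. -/
noncomputable def arityOne (E : C) [MonObj E] : Operad C where
  obj S _ := restrict (Nat.card S = 1) E
  map {S T} _ _ _ := restrictOut (Nat.card S = 1) E ≫ restrictIn (Nat.card T = 1) E
  one := η[E] ≫ restrictIn (Nat.card (Fin 1) = 1) E
  comp S T _ _ := (restrictOut (Nat.card (Option S) = 1) E ⊗ₘ restrictOut (Nat.card T = 1) E) ≫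
    μ[E] ≫ restrictIn (Nat.card (T ⊕ S) = 1) E
  map_refl S _ := restrictOut_in _ _
  map_trans {S T U} _ _ _ e f := by
    by_cases hT : Nat.card T = 1
    · rw [Category.assoc, restrictIn_out_assoc hT]
    · exact (isZero_restrict (by rwa [Nat.card_congr e]) _).eq_of_src _ _
  comp_natural {S S' T T'} _ _ _ _ e f := by
    by_cases hS : Nat.card (Option S) = 1
    · by_cases hT : Nat.card T = 1
      · have hS' : Nat.card (Option S') = 1 := by rw [← hS, Nat.card_congr (Equiv.optionCongr e)]
        have hT' : Nat.card T' = 1 := by rw [← hT, Nat.card_congr f]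
        have h0 : Nat.card (T ⊕ S) = 1 := by
          rw [Finite.card_option] at hS
          rw [Nat.card_sum]
          omega
        rw [← Category.assoc, MonoidalCategory.tensorHom_comp_tensorHom]
        simp only [Category.assoc]
        rw [restrictIn_out hS', restrictIn_out hT', Category.comp_id, Category.comp_id,
          restrictIn_out_assoc h0]
      · exact (isZero_tensor_right (isZero_restrict hT _) _).eq_of_src _ _
    · exact (isZero_tensor_left (isZero_restrict hS _) _).eq_of_src _ _
  one_comp T _ := by
    by_cases hT : Nat.card T = 1
    · have h2 : Nat.card (Option (Fin 0)) = 1 := by simp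
      have h3 : Nat.card (T ⊕ Fin 0) = 1 := by simp [Nat.card_sum, hT]
      simp only [Category.assoc]
      rw [restrictIn_out_assoc (by simp), restrictIn_out_assoc h3, ← tensorHom_id,
        ← Category.assoc, MonoidalCategory.tensorHom_comp_tensorHom, Category.assoc,
        restrictIn_out h2, Category.comp_id, Category.id_comp, MonoidalCategory.tensorHom_def',
        Category.assoc, MonObj.one_mul_assoc, leftUnitor_naturality_assoc, restrictOut_in,
        Category.comp_id]
    · exact (isZero_tensor_right (isZero_restrict hT _) _).eq_of_src _ _
  comp_one S _ := by
    by_cases hS : Nat.card (Option S) = 1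
    · have h1 : Nat.card (Fin 1) = 1 := by simp
      have h3 : Nat.card (Fin 1 ⊕ S) = 1 := by
        rw [Finite.card_option] at hS
        rw [Nat.card_sum, h1]
        omega
      simp only [Category.assoc]
      rw [restrictIn_out_assoc h3, ← id_tensorHom,
        ← Category.assoc, MonoidalCategory.tensorHom_comp_tensorHom, Category.assoc,
        restrictIn_out h1, Category.comp_id, Category.id_comp, MonoidalCategory.tensorHom_def,
        Category.assoc, MonObj.mul_one_assoc, rightUnitor_naturality_assoc, restrictOut_in,
        Category.comp_id]
    · exact (isZero_tensor_left (isZero_restrict hS _) _).eq_of_src _ _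
  assoc S T U _ _ _ := by
    by_cases hS : Nat.card (Option S) = 1
    · by_cases hT : Nat.card (Option T) = 1
      · by_cases hU : Nat.card U = 1
        · rw [Finite.card_option] at hS hT
          have h1 : Nat.card (Option T ⊕ S) = 1 := by
            rw [Nat.card_sum, Finite.card_option]
            omega
          have h2 : Nat.card (Option (T ⊕ S)) = 1 := by
            rw [Finite.card_option, Nat.card_sum]
            omega
          have h3 : Nat.card (U ⊕ T) = 1 := by
            rw [Nat.card_sum]
            omega
          have h4 : Nat.card ((U ⊕ T) ⊕ S) = 1 := by
            rw [Nat.card_sum, Nat.card_sum]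
            omega
          simp only [Category.assoc]
          rw [restrictIn_out_assoc h1, restrictIn_out_assoc h4,
            ← MonoidalCategory.tensorHom_id, ← MonoidalCategory.id_tensorHom, ← Category.assoc,
            MonoidalCategory.tensorHom_comp_tensorHom, Category.id_comp]
          simp only [Category.assoc]
          rw [restrictIn_out h2, Category.comp_id,
            ← Category.assoc (𝟙 (restrict (Nat.card (Option S) = 1) E) ⊗ₘ _),
            MonoidalCategory.tensorHom_comp_tensorHom]
          simp only [Category.assoc, Category.id_comp]
          rw [restrictIn_out h3, Category.comp_id, ← Category.assoc, mul_out_assoc]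
          simp only [Category.assoc]
        · exact (isZero_tensor_right (isZero_restrict hU _) _).eq_of_src _ _
      · exact (isZero_tensor_left (isZero_tensor_right (isZero_restrict hT _) _) _).eq_of_src _ _
    · exact (isZero_tensor_left (isZero_tensor_left (isZero_restrict hS _) _) _).eq_of_src _ _
  comm S T U _ _ _ := by
    have hS : Nat.card (Option (Option S)) ≠ 1 := by
      rw [Finite.card_option, Finite.card_option]
      omega
    exact (isZero_tensor_left (isZero_tensor_left (isZero_restrict hS _) _) _).eq_of_src _ _

open scoped ZeroObject

variable (C) in
/-- The operad which is zero in all arities. -/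
noncomputable def zero : Operad C where
  obj _ _ := 0
  map _ := 0
  one := 0
  comp _ _ _ _ := 0
  map_refl _ _ := (isZero_zero C).eq_of_tgt _ _
  map_trans _ _ := (isZero_zero C).eq_of_tgt _ _
  comp_natural _ _ := (isZero_zero C).eq_of_tgt _ _
  one_comp _ _ := (isZero_zero C).eq_of_tgt _ _
  comp_one _ _ := (isZero_zero C).eq_of_tgt _ _
  assoc _ _ _ _ _ _ := (isZero_zero C).eq_of_tgt _ _
  comm _ _ _ _ _ _ := (isZero_zero C).eq_of_tgt _ _

/-- The morphism to the zero operad. -/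
noncomputable def toZero (P : Operad C) : P ⟶ zero C where
  app _ _ := 0
  naturality _ := (isZero_zero C).eq_of_tgt _ _
  one := (isZero_zero C).eq_of_tgt _ _
  comp _ _ _ _ := (isZero_zero C).eq_of_tgt _ _

/-- A zero object is dual to itself. -/
abbrev exactPairingOfIsZero {X : C} (h : IsZero X) : ExactPairing X X where
  coevaluation' := 0
  evaluation' := 0
  coevaluation_evaluation' := (isZero_tensor_left h _).eq_of_src _ _
  evaluation_coevaluation' := (isZero_tensor_right h _).eq_of_src _ _

end ArityOne

/-! ### Coalgebras and sanity -/

section Coalgebras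

variable {C : Type u} [Category.{v} C] [MonoidalCategory C] [SymmetricCategory C]

/-- The restriction of a coalgebra along a morphism of operads. -/
def Coalg.pullback {P Q : Operad C} (f : P ⟶ Q) (V : Coalg Q) : Coalg P where
  V := V.V
  δ n := f.app (Fin n) ▷ V.V ≫ V.δ n
  equivariant n i := by
    rw [← comp_whiskerRight_assoc, f.naturality, comp_whiskerRight_assoc, V.equivariant,
      Category.assoc]
  counit := by rw [← comp_whiskerRight_assoc, f.one, V.counit]
  coassoc m n := by
    have h : (P.comp (Fin m) (Fin n) ≫ P.map (concatEquiv n m)) ≫ f.app (Fin (m + n)) =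
        (f.app _ ⊗ₘ f.app _) ≫ Q.comp (Fin m) (Fin n) ≫ Q.map (concatEquiv n m) := by
      rw [Category.assoc, f.naturality, ← Category.assoc, f.comp, Category.assoc]
    rw [← comp_whiskerRight_assoc, h, comp_whiskerRight_assoc, V.coassoc]
    have h1 : P.map (finSuccEquiv m).symm ▷ V.V ≫ f.app (Fin (m + 1)) ▷ V.V ≫ V.δ (m + 1) =
        f.app _ ▷ V.V ≫ Q.map (finSuccEquiv m).symm ▷ V.V ≫ V.δ (m + 1) := by
      rw [← comp_whiskerRight_assoc, f.naturality, comp_whiskerRight_assoc]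
    rw [h1, ← comp_whiskerRight_assoc, BraidedCategory.braiding_naturality,
      comp_whiskerRight_assoc]
    rw [MonoidalCategory.tensorHom_def']
    simp only [comp_whiskerRight, whiskerLeft_comp, Category.assoc]
    rw [associator_naturality_left_assoc, ← whisker_exchange_assoc, ← whisker_exchange_assoc,
      associator_naturality_middle_assoc]
    iterate 5 refine congrArg (CategoryStruct.comp _) ?_
    exact associator_inv_naturality_left_assoc _ _ _ _

/-- Morphisms from coalgebras to `X` factor through the counit, which is therefore an epimorphism if
one of them is. -/
lemma isSane_of_exists (P : Operad C) [(forget P).IsLeftAdjoint]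
    (h : ∀ X : C, ∃ (V : Coalg P) (q : (forget P).obj V ⟶ X), Epi q) : P.IsSane := by
  intro X
  obtain ⟨V, q, hq⟩ := h X
  let adj := Adjunction.ofIsLeftAdjoint (forget P)
  have h' : (forget P).map (adj.homEquiv V X q) ≫ adj.counit.app X = q :=
    (adj.homEquiv_counit V X _).symm.trans ((adj.homEquiv V X).symm_apply_apply q)
  have h'' : Epi ((forget P).map (adj.homEquiv V X q) ≫ adj.counit.app X) := by rwa [h']
  exact epi_of_epi ((forget P).map (adj.homEquiv V X q)) (adj.counit.app X)

/-- A dualisable object has a dual in the sense of exact pairings. The coevaluation corresponds to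
the identity under the universal property of `[X, X]`, which is one triangle identity; the other one
holds by the uniqueness in the universal property of `[X, 𝟙]`. -/
lemma IsDualisable.exists_exactPairing {X : C} (h : IsDualisable X) :
    ∃ D : C, Nonempty (ExactPairing D X) := by
  obtain ⟨D, ev, h1, h2⟩ := h
  obtain ⟨η, hη⟩ := (h2 (𝟙_ C)).surjective (λ_ X).hom
  dsimp only at hη
  have p : ExactPairing X D :=
    { coevaluation' := η
      evaluation' := ev
      evaluation_coevaluation' := by
        rw [← cancel_mono (ρ_ X).hom]
        simpa using hη
      coevaluation_evaluation' := by
        rw [← cancel_mono (λ_ D).hom]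
        apply (h1 (D ⊗ 𝟙_ C)).injective
        have h3 := congrArg (fun f => (α_ D (𝟙_ C) X).hom ≫ D ◁ f ≫ ev) hη
        have h4 : ev ▷ (D ⊗ X) ≫ (λ_ _).hom ≫ ev = (D ⊗ X) ◁ ev ≫ (ρ_ _).hom ≫ ev := by
          rw [← leftUnitor_naturality, ← whisker_exchange_assoc, unitors_equal,
            rightUnitor_naturality]
        have h5 := congrArg (fun f => (D ◁ η) ▷ X ≫ (α_ _ _ _).inv ▷ X ≫ (α_ _ _ _).hom ≫ f) h4
        refine Eq.trans ?_ (h5.trans (Eq.trans ?_ (h3.trans ?_))) <;> monoidal }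
  exact ⟨D, ⟨BraidedCategory.exactPairing_swap X D⟩⟩

end Coalgebras

/-! ### Epimorphisms from coalgebras -/

section Sane

section

variable {A : Type u} [Category.{v} A] [Preadditive A]

lemma isQuasiIso_of_exactAt {K L : ChainComplex A ℤ} (f : K ⟶ L) (hK : ∀ i, K.ExactAt i)
    (hL : ∀ i, L.ExactAt i) : IsQuasiIso f := by
  have h1 : ∀ i, K.HasHomology i := fun i => (hK i).hasHomology
  have h2 : ∀ i, L.HasHomology i := fun i => (hL i).hasHomology
  exact ⟨h1, h2, ⟨fun i => (quasiIsoAt_iff_exactAt f i (hK i)).2 (hL i)⟩⟩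

lemma exactAt_of_isZero {K : ChainComplex A ℤ} (h : IsZero K) (i : ℤ) : K.ExactAt i :=
  ShortComplex.exact_of_isZero_X₂ _ ((HomologicalComplex.eval A _ i).map_isZero h)

end

variable {A : Type u} [Category.{v} A] [Preadditive A] [MonoidalCategory A] [SymmetricCategory A]
  [MonoidalClosed A] [HasColimits A]

/-- If `P(0)` has a dual and the unit is a split monomorphism in degree zero, then every complex
receives an epimorphism from a coalgebra, namely from `squareZero` for a free module `P(1) ⊗ Z`. -/
lemma exists_coalg_epi (P : Operad (ChainComplex A ℤ)) {D : ChainComplex A ℤ}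
    (hD : Nonempty (ExactPairing D (P.obj (Fin 0)))) (hP : IsSplitMono (P.one.f 0))
    (X : ChainComplex A ℤ) :
    ∃ (V : Coalg P) (q : (forget P).obj V ⟶ X), Epi q := by
  obtain ⟨hD⟩ := hD
  obtain ⟨Z, q, hq⟩ := exists_epi_tensor P.one hP X
  have : HasBinaryBiproducts A := HasBinaryBiproducts.of_hasBinaryCoproducts
  have h : P.obj (Fin 1) ◁ P.mulOne ≫ P.mulOne = onLeft P.mulOne _ ≫ P.mulOne := by
    have := P.mulOne_ins 0
    rw [onLeft, Category.assoc]
    erw [this]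
    rw [Iso.inv_hom_id_assoc]
  have hq' : Epi ((biprod.snd : D ⊞ (P.obj (Fin 1) ⊗ Z) ⟶ _) ≫ q) := epi_comp _ _
  refine ⟨squareZero (D := D) (onLeft P.mulOne Z) (onLeft_onLeft h Z).symm ?_, _, hq'⟩
  have := P.one_ins 0
  rw [onLeft, associator_inv_naturality_left_assoc, ← comp_whiskerRight]
  erw [this]
  simp

end Sane

end Operad

theorem mainTheorem2 {A : Type u} [Category.{v} A] [Preadditive A] [MonoidalCategory A]
    [SymmetricCategory A] [MonoidalClosed A] [HasColimits A]
    [∀ Q : Operad (ChainComplex A ℤ), (Operad.forget Q).IsLeftAdjoint]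
    (P : Operad (ChainComplex A ℤ))
    (hP : Nonempty (P ⟶ Operad.unit (ChainComplex A ℤ)) ∨
      P.IsCofibrant ∨
      (Operad.IsDualisable (P.obj (Fin 0)) ∧ ∀ k : ℤ, IsSplitMono (P.one.f k))) :
    P.IsSane := by
  open Operad in
  apply isSane_of_exists
  intro X
  obtain ⟨⟨f⟩⟩ | hP | ⟨hP, hu⟩ := hP
  -- The projection of the unit operad in arity one retracts its unit.
  · have h0 := isZero_unitObj (ChainComplex A ℤ) (S := Fin 0) (by simp)
    obtain ⟨r, hr⟩ : ∃ r : (unit (ChainComplex A ℤ)).obj (Fin 1) ⟶ 𝟙_ (ChainComplex A ℤ),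
      (unit (ChainComplex A ℤ)).one ≫ r = 𝟙 _ := ⟨unitOut _ _, unitIn_out (by simp)⟩
    obtain ⟨V, q, hq⟩ := exists_coalg_epi (unit (ChainComplex A ℤ)) ⟨exactPairingOfIsZero h0⟩
      ⟨⟨⟨r.f 0, by rw [← HomologicalComplex.comp_f, hr, HomologicalComplex.id_f]⟩⟩⟩ X
    exact ⟨V.pullback f, q, hq⟩
  -- In degree zero, `disk A 1` is the tensor unit, so its unit is split there. The retraction need
  -- not extend to a chain map to the tensor unit.
  · let Q := arityOne (disk A 1)
    have hQ : ∀ (S : Type) [Finite S] (i : ℤ), (Q.obj S).ExactAt i := by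
      intro S _ i
      by_cases hS : Nat.card S = 1
      · have e : Q.obj S = disk A 1 := if_pos hS
        rw [e]
        exact disk_exactAt 1 i
      · exact exactAt_of_isZero (isZero_restrict hS _) i
    have h0 : IsZero (Q.obj (Fin 0)) := isZero_restrict (by simp) _
    have hzero (S : Type) [Finite S] : IsZero ((zero (ChainComplex A ℤ)).obj S) := isZero_zero _
    obtain ⟨l, -⟩ := hP (toZero Q)
      (fun S _ k => ⟨fun _ _ _ =>
        ((HomologicalComplex.eval A _ k).map_isZero (hzero S)).eq_of_src _ _⟩)
      (fun S _ => isQuasiIso_of_exactAt _ (hQ S) (exactAt_of_isZero (hzero S))) (toZero P)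
    obtain ⟨r, hr⟩ : ∃ r : Q.obj (Fin 1) ⟶ disk A 1, Q.one ≫ r = diskOne A :=
      ⟨restrictOut _ _, (Category.assoc _ _ _).trans
        ((diskOne A ≫= restrictIn_out (by simp) _).trans (Category.comp_id _))⟩
    have hu : Q.one.f 0 ≫ r.f 0 ≫ diskOut 1 0 ≫ (unitX A).inv = 𝟙 _ := by
      rw [← HomologicalComplex.comp_f_assoc, hr, diskOne_f, Category.assoc,
        diskIn_out_assoc (by simp), Iso.hom_inv_id]
    obtain ⟨V, q, hq⟩ := exists_coalg_epi Q ⟨exactPairingOfIsZero h0⟩ ⟨⟨⟨_, hu⟩⟩⟩ X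
    exact ⟨V.pullback l, q, hq⟩
  · obtain ⟨D, hD⟩ := hP.exists_exactPairing
    exact exists_coalg_epi P hD (hu 0) X
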